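/- Let $S$ be a finite or countably infinite set and let $A=(a(x,y))_{x,y\in S}$ be a conservative $Q$-matrix with finite negative diagonal elements: $a(x,y)\ge 0$ for $x\ne y$, $-\infty<a(x,x)<0$ and $\sum_{y\in S}a(x,y)=0$ for every $x\in S$. Let $\xi=\{\xi(t),\,t\ge 0\}$ be an irreducible time-homogeneous continuous-time Markov chain on $S$ with $Q$-matrix $A$, and let $\mathbb{P}_x$ be its law when $\xi(0)=x$. Here the sample functions are almost surely right-continuous in the one-point compactification $S\cup\{\infty\}$ of the discrete space $S$ (explosions are not excluded; the value $\infty$ is never taken, almost surely, by a non-explosive chain), the transition probabilities $p_{xy}(t)=\mathbb{P}_x(\xi(t)=y)$, $x,y\in S$, form a (possibly substochastic) transition function with $p_{xy}'(0+)=a(x,y)$, and irreducibility means that for all $x,y\in S$ one has $p_{xy}(t)>0$ for some $t\ge0$. Let $\tau_x=\mathbb{I}\{\xi(0)=x\}\inf\{t\ge 0:\xi(t)\ne x\}$ be the first exit time from $x$. For a taboo set $H\subseteq S$ and $x,y\in S$ put $$_Hp_{xy}(t)=\mathbb{P}_x\bigl(\xi(t)=y,\ \xi(u)\notin H \text{ for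 all } u \text{ with } \min\{\tau_x,t\}<u<t\bigr),\quad t\ge 0,\qquad {}_HP_{xy}(\infty)=\int_0^\infty {}_Hp_{xy}(t)\,dt\in[0,\infty],$$ $$_H\tau_{xy}=\mathbb{I}\{\xi(0)=x\}\inf\bigl\{t\ge\tau_x:\ \xi(t)=y,\ \xi(u)\notin H \text{ for all } u \text{ with } \tau_x<u<t\bigr\},\qquad {}_HF_{xy}(\infty)=\mathbb{P}_x({}_H\tau_{xy}<\infty),$$ where $\inf\varnothing=\infty$. Then for any nonempty $H\subseteq S$ and any $x,y\in S$ with $y\notin H$ one has $0\le{}_HP_{xy}(\infty)<\infty$ and $0<{}_HP_{yy}(\infty)<\infty$, and $$_HF_{xy}(\infty)=\frac{_HP_{xy}(\infty)}{_HP_{yy}(\infty)}\quad\text{if }x\ne y,\qquad\qquad {}_HF_{xx}(\infty)=1+\frac{1}{a(x,x)\,{}_HP_{xx}(\infty)}\in[0,1)\quad\text{if }x\notin H.$$ -/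

import Mathlib

open MeasureTheory Filter Topology Set
open scoped NNReal ENNReal

namespace TabooChain

/-- A conservative `Q`-matrix with (finite) strictly negative diagonal elements: nonnegative
off-diagonal entries and rows summing to zero. -/
structure IsConservativeQMatrix {S : Type*} (A : S → S → ℝ) : Prop where
  off_diag_nonneg : ∀ x y, x ≠ y → 0 ≤ A x y
  diag_neg : ∀ x, A x x < 0
  row_sum : ∀ x, HasSum (fun y => A x y) 0

/-- `ξ` is a time-homogeneous continuous-time Markov chain on the discrete space `S` with
`Q`-matrix `A`; `P x` is the law under which the chain starts at `x`.

The chain takes values in `S ∪ {∞}`, the one-point compactification of the discrete space `S`.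
Nothing is assumed about explosions: the value `∞` is taken by the minimal chain after its
explosion, and by the right-continuous version of a chain that comes back to `S` after exploding.
For a non-explosive chain it is never taken, almost surely. -/
structure IsMarkovChain {S Ω : Type*} [TopologicalSpace S] [MeasurableSpace Ω]
    (A : S → S → ℝ) (P : S → Measure Ω) (ξ : ℝ≥0 → Ω → OnePoint S) : Prop where
  isProbabilityMeasure : ∀ x, IsProbabilityMeasure (P x)
  measurableSet_state : ∀ (t : ℝ≥0) (y : S), MeasurableSet {ω | ξ t ω = (y : OnePoint S)}
  initial : ∀ x : S, ∀ᵐ ω ∂P x, ξ 0 ω = (x : OnePoint S)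
  /-- Almost all sample functions are right-continuous. -/
  right_continuous : ∀ x, ∀ᵐ ω ∂P x, ∀ t : ℝ≥0, ContinuousWithinAt (fun s => ξ s ω) (Ici t) t
  /-- The Markov property, with stationary transition probabilities. -/
  markov : ∀ (x : S) (n : ℕ) (t : Fin (n + 1) → ℝ≥0) (z : Fin (n + 1) → S) (s : ℝ≥0) (y : S),
    Monotone t →
      P x ({ω | ∀ i, ξ (t i) ω = (z i : OnePoint S)} ∩
          {ω | ξ (t (Fin.last n) + s) ω = (y : OnePoint S)}) =
        P x {ω | ∀ i, ξ (t i) ω = (z i : OnePoint S)} *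
          P (z (Fin.last n)) {ω | ξ s ω = (y : OnePoint S)}
  /-- The transition probabilities between states of `S` form a transition function on `S`. -/
  chapman_kolmogorov : ∀ (x y : S) (s t : ℝ≥0),
    P x {ω | ξ (s + t) ω = (y : OnePoint S)} =
      ∑' z : S, P x {ω | ξ s ω = (z : OnePoint S)} * P z {ω | ξ t ω = (y : OnePoint S)}
  /-- The derivative at zero of the diagonal transition probabilities is given by `A`. -/
  deriv_diag : ∀ x : S,
    Tendsto (fun t : ℝ≥0 => ((P x).real {ω | ξ t ω = (x : OnePoint S)} - 1) / (t : ℝ))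
      (𝓝[>] 0) (𝓝 (A x x))
  /-- The derivative at zero of the other transition probabilities is given by `A`. -/
  deriv_off_diag : ∀ x y : S, x ≠ y →
    Tendsto (fun t : ℝ≥0 => (P x).real {ω | ξ t ω = (y : OnePoint S)} / (t : ℝ))
      (𝓝[>] 0) (𝓝 (A x y))

/-- Every state can be reached from every state. -/
def IsIrreducible {S Ω : Type*} [MeasurableSpace Ω]
    (P : S → Measure Ω) (ξ : ℝ≥0 → Ω → OnePoint S) : Prop :=
  ∀ x y : S, ∃ t : ℝ≥0, 0 < P x {ω | ξ t ω = (y : OnePoint S)}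

open Classical in
/-- The first exit time `τ_x = 𝟙{ξ(0) = x} inf {t ≥ 0 : ξ(t) ≠ x}`, with `inf ∅ = ∞`. -/
noncomputable def exitTime {S Ω : Type*} (ξ : ℝ≥0 → Ω → OnePoint S) (x : S) (ω : Ω) : ℝ≥0∞ :=
  if ξ 0 ω = (x : OnePoint S) then
    ⨅ (t : ℝ≥0) (_ : ξ t ω ≠ (x : OnePoint S)), (t : ℝ≥0∞)
  else 0

/-- The transition probability from `x` to `y` in time `t` under taboo `H`, that is
`P_x (ξ(t) = y, ξ(u) ∉ H for min {τ_x, t} < u < t)`. -/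
noncomputable def tabooProb {S Ω : Type*} [MeasurableSpace Ω] (P : S → Measure Ω)
    (ξ : ℝ≥0 → Ω → OnePoint S) (H : Set S) (x y : S) (t : ℝ≥0) : ℝ≥0∞ :=
  P x {ω | ξ t ω = (y : OnePoint S) ∧
    ∀ u : ℝ≥0, min (exitTime ξ x ω) (t : ℝ≥0∞) < (u : ℝ≥0∞) → u < t →
      ∀ h ∈ H, ξ u ω ≠ (h : OnePoint S)}

/-- The taboo Green function `∫₀^∞ p(t) dt`, for `p` the transition probability from `x` to `y`
under taboo `H`. Its value may a priori be infinite. -/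
noncomputable def tabooGreen {S Ω : Type*} [MeasurableSpace Ω] (P : S → Measure Ω)
    (ξ : ℝ≥0 → Ω → OnePoint S) (H : Set S) (x y : S) : ℝ≥0∞ :=
  ∫⁻ t in Ioi (0 : ℝ), tabooProb P ξ H x y t.toNNReal

open Classical in
/-- The first entrance time from `x` to `y` under taboo `H` (first return time if `x = y`):
`𝟙{ξ(0) = x} inf {t ≥ τ_x : ξ(t) = y, ξ(u) ∉ H for τ_x < u < t}`, with `inf ∅ = ∞`. -/
noncomputable def tabooTime {S Ω : Type*} (ξ : ℝ≥0 → Ω → OnePoint S) (H : Set S) (x y : S)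
    (ω : Ω) : ℝ≥0∞ :=
  if ξ 0 ω = (x : OnePoint S) then
    ⨅ (t : ℝ≥0) (_ : exitTime ξ x ω ≤ (t : ℝ≥0∞) ∧ ξ t ω = (y : OnePoint S) ∧
      ∀ u : ℝ≥0, exitTime ξ x ω < (u : ℝ≥0∞) → u < t → ∀ h ∈ H, ξ u ω ≠ (h : OnePoint S)),
      (t : ℝ≥0∞)
  else 0

/-- The (improper) distribution function of the first entrance time under taboo,
`F(t) = P_x (τ ≤ t)`. -/
noncomputable def tabooDistFun {S Ω : Type*} [MeasurableSpace Ω] (P : S → Measure Ω)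
    (ξ : ℝ≥0 → Ω → OnePoint S) (H : Set S) (x y : S) (t : ℝ≥0) : ℝ :=
  (P x).real {ω | tabooTime ξ H x y ω ≤ (t : ℝ≥0∞)}

/-- `F(∞)`, the probability that the first entrance time under taboo is finite. -/
noncomputable def tabooHitProb {S Ω : Type*} [MeasurableSpace Ω] (P : S → Measure Ω)
    (ξ : ℝ≥0 → Ω → OnePoint S) (H : Set S) (x y : S) : ℝ :=
  (P x).real {ω | tabooTime ξ H x y ω < ⊤}

/-- `F(∞)` is the limit of the distribution function at infinity. -/
theorem tendsto_tabooDistFun {S Ω : Type*} [MeasurableSpace Ω] (P : S → Measure Ω)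
    (ξ : ℝ≥0 → Ω → OnePoint S) (H : Set S) (x y : S) [IsProbabilityMeasure (P x)] :
    Tendsto (tabooDistFun P ξ H x y) atTop (𝓝 (tabooHitProb P ξ H x y)) := by
  have hU : {ω | tabooTime ξ H x y ω < ⊤} =
      ⋃ t : ℝ≥0, {ω | tabooTime ξ H x y ω ≤ (t : ℝ≥0∞)} := by
    ext ω
    simp only [mem_ofPred_eq, mem_iUnion]
    constructor
    · intro h
      exact ⟨(tabooTime ξ H x y ω).toNNReal, (ENNReal.coe_toNNReal h.ne).ge⟩
    · rintro ⟨t, ht⟩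
      exact ht.trans_lt ENNReal.coe_lt_top
  have hm : Monotone fun t : ℝ≥0 => {ω | tabooTime ξ H x y ω ≤ (t : ℝ≥0∞)} := by
    intro s t hst ω hω
    exact le_trans hω (ENNReal.coe_le_coe.2 hst)
  have := tendsto_measure_iUnion_atTop (μ := P x) hm
  rw [← hU] at this
  exact (ENNReal.tendsto_toReal (measure_ne_top _ _)).comp this

end TabooChain

/-! The mean occupation time of y, counted after x is left and before `H` is met, equals the
probability of ever entering y under taboo times the mean occupation time K of y for the chain
started at y. For x ≠ y this product is the Green function itself, which gives the quotient formula.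
For x = y ∉ `H` the Green function is K, and it also contains the initial stay at y, exponential
with mean -1/a(y,y). Hence K = F K - 1/a(y,y), which is solved for F (`tabooGreen_self`).

The product formula (`lintegral_measure_entersAt`) is the strong Markov property at the first
entrance, obtained from the Markov property at fixed times. For finitely many candidate times, paths
are split by the first candidate at which they enter (`lintegral_measure_entersAt_finset`). The
candidates then increase to a countable dense set; by right-continuity this loses nothing but a null
set of times.

Finiteness (`lintegral_measure_entersAt_lt_top`) comes from irreducibility: from y the chain is in
`H` after some time s with probability q > 0, and an occupation followed by such a visit is the last
one allowed. The occupation time thus has mean at most s/q.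

The times in the statement are infima over uncountable sets. Almost surely they reduce to path
events, which countably many times determine on stable paths. -/

namespace TabooChain

/-! ### Stable paths and taboo events along one path -/

/-- A path in `S ∪ {∞}` is stable if, immediately to the right of each time, its coincidence with
each given state of `S` does not change. -/
def IsStablePath {S : Type*} (w : ℝ≥0 → OnePoint S) : Prop :=
  ∀ (t : ℝ≥0) (z : S), ∀ᶠ s in 𝓝[>] t, (w s = z ↔ w t = z)

/-- The path is at `y` at time `t`, after having left `x`, without visiting `H` in between. -/
def EntersAt {S : Type*} (w : ℝ≥0 → OnePoint S) (H : Set S) (x y : S) (t : ℝ≥0) : Prop :=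
  w t = y ∧ (∃ v ≤ t, w v ≠ x) ∧ ∀ v u, v < u → u < t → w v ≠ x → ∀ h ∈ H, w u ≠ h

/-- The path is at `y` at time `t` and does not visit `H` before. -/
def AvoidsUntil {S : Type*} (w : ℝ≥0 → OnePoint S) (H : Set S) (y : S) (t : ℝ≥0) : Prop :=
  w t = y ∧ ∀ u < t, ∀ h ∈ H, w u ≠ h

/-- The path stays at `x` up to time `t`, included. -/
def RestsUntil {S : Type*} (w : ℝ≥0 → OnePoint S) (x : S) (t : ℝ≥0) : Prop :=
  ∀ u ≤ t, w u = x

section Paths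

variable {S : Type*} {w : ℝ≥0 → OnePoint S} {H : Set S} {x y : S} {s t : ℝ≥0}

/-- Points of S are open and closed in the compactification. At ∞ only closedness is available: each
single state is avoided for a while, though the path need not stay at ∞. -/
theorem isStablePath_of_continuousWithinAt [TopologicalSpace S] [DiscreteTopology S]
    (hw : ∀ t, ContinuousWithinAt w (Ici t) t) : IsStablePath w := by
  intro t z
  have ht := (hw t).mono Ioi_subset_Ici_self
  by_cases h : w t = z
  · have ho : IsOpen {(z : OnePoint S)} := by
      have := OnePoint.isOpenEmbedding_coe.isOpenMap {z} (isOpen_discrete _)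
      simpa using this
    filter_upwards [ht.eventually (ho.mem_nhds h)] with s hs
    exact ⟨fun _ => h, fun _ => hs⟩
  · filter_upwards [ht.eventually (isOpen_compl_singleton.mem_nhds h)] with s hs
    exact ⟨fun h' => absurd h' hs, fun h' => absurd h' h⟩

theorem IsStablePath.exists_between (hw : IsStablePath w) {D : Set ℝ≥0} (hD : Dense D) (z : S)
    {b : ℝ≥0} (hb : t < b) : ∃ d ∈ D, t < d ∧ d < b ∧ (w d = z ↔ w t = z) := by
  obtain ⟨c, hc, hs⟩ := (mem_nhdsGT_iff_exists_Ioo_subset' hb).1 (hw t z)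
  obtain ⟨d, hd, h1, h2⟩ := hD.exists_between (lt_min hc hb)
  exact ⟨d, hd, h1, h2.trans_le (min_le_right _ _), hs ⟨h1, h2.trans_le (min_le_left _ _)⟩⟩

/-- Stability moves an earlier departure slightly to the right, into `D`. One at exactly `t` cannot
be moved without passing `t`, hence the separate alternative. -/
theorem IsStablePath.exists_dense_ne_iff (hw : IsStablePath w) {D : Set ℝ≥0} (hD : Dense D) :
    (∃ v ≤ t, w v ≠ x) ↔ w t ≠ x ∨ ∃ v ∈ D, v < t ∧ w v ≠ x := by
  constructor
  · rintro ⟨v, hv, hvx⟩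
    rcases hv.eq_or_lt with rfl | hv
    · exact .inl hvx
    · obtain ⟨d, hd, -, h2, h3⟩ := hw.exists_between hD x hv
      exact .inr ⟨d, hd, h2, fun h => hvx (h3.1 h)⟩
  · rintro (h | ⟨v, -, hv, h⟩)
    · exact ⟨t, le_rfl, h⟩
    · exact ⟨v, hv.le, h⟩

theorem IsStablePath.entersAt_iff (hw : IsStablePath w) {D : Set ℝ≥0} (hD : Dense D) :
    EntersAt w H x y t ↔ w t = y ∧ (w t ≠ x ∨ ∃ v ∈ D, v < t ∧ w v ≠ x) ∧
      ∀ v ∈ D, ∀ u ∈ D, v < u → u < t → w v ≠ x → ∀ h ∈ H, w u ≠ h := by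
  rw [EntersAt, hw.exists_dense_ne_iff hD]
  refine and_congr_right fun _ => and_congr_right fun _ =>
    ⟨fun h v _ u _ => h v u, fun hh v u hvu hut hv h hH hu => ?_⟩
  obtain ⟨d, hd, -, h2, h3⟩ := hw.exists_between hD x hvu
  obtain ⟨e, he, h4, h5, h6⟩ := hw.exists_between hD h hut
  exact hh d hd e he (h2.trans h4) h5 (fun h => hv (h3.1 h)) h hH (h6.2 hu)

theorem IsStablePath.avoidsUntil_iff (hw : IsStablePath w) {D : Set ℝ≥0} (hD : Dense D) :
    AvoidsUntil w H y t ↔ w t = y ∧ ∀ u ∈ D, u < t → ∀ h ∈ H, w u ≠ h := by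
  refine and_congr_right fun _ => ⟨fun hh u _ => hh u, fun hh u hut h hH hu => ?_⟩
  obtain ⟨e, he, -, h5, h6⟩ := hw.exists_between hD h hut
  exact hh e he h5 h hH (h6.2 hu)

theorem IsStablePath.comp_add (hw : IsStablePath w) (s : ℝ≥0) :
    IsStablePath fun t => w (s + t) := by
  intro t z
  have : Tendsto (fun t => s + t) (𝓝[>] t) (𝓝[>] (s + t)) := by
    refine tendsto_nhdsWithin_of_tendsto_nhds_of_eventually_within _ ?_ ?_
    · exact ((continuous_const.add continuous_id).tendsto t).mono_left nhdsWithin_le_nhds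
    · filter_upwards [self_mem_nhdsWithin] with u hu
      exact (add_lt_add_iff_left s).2 (mem_Ioi.1 hu)
  exact this.eventually (hw (s + t) z)

/-- A path at y stays there for a while, and y ∉ `H`, so no taboo visit is added. This lets dense
times detect entrances and makes the probability of the event measurable in time. -/
theorem IsStablePath.eventually_entersAt_iff (hw : IsStablePath w) (hy : y ∉ H) (t : ℝ≥0) :
    ∀ᶠ s in 𝓝[>] t, (EntersAt w H x y s ↔ EntersAt w H x y t) := by
  by_cases hty : w t = y
  · have key : ∀ᶠ s in 𝓝[>] t, ∀ u, t ≤ u → u ≤ s → w u = y ∧ (w u = x ↔ w t = x) := by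
      obtain ⟨c, hc, hs⟩ := (mem_nhdsGT_iff_exists_Ioo_subset).1 ((hw t y).and (hw t x))
      filter_upwards [Ioo_mem_nhdsGT hc] with s hs' u h1 h2
      rcases h1.eq_or_lt with rfl | h1
      · exact ⟨hty, Iff.rfl⟩
      · have := hs ⟨h1, h2.trans_lt hs'.2⟩
        exact ⟨this.1.2 hty, this.2⟩
    filter_upwards [key, self_mem_nhdsWithin] with s hs hts
    have hts : t < s := hts
    constructor
    · rintro ⟨h1, ⟨v, hv, hvx⟩, h3⟩
      refine ⟨hty, ?_, fun v u hvu hut => h3 v u hvu (hut.trans hts)⟩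
      rcases le_or_gt t v with htv | htv
      · exact ⟨t, le_rfl, fun h => hvx ((hs v htv hv).2.2 h)⟩
      · exact ⟨v, htv.le, hvx⟩
    · rintro ⟨h1, ⟨v, hv, hvx⟩, h3⟩
      refine ⟨(hs s hts.le le_rfl).1, ⟨v, hv.trans hts.le, hvx⟩, fun v u hvu hus hvx h hH hu => ?_⟩
      rcases lt_or_ge u t with hut | hut
      · exact h3 v u hvu hut hvx h hH hu
      · have h4 := (hs u hut hus.le).1
        rw [hu, OnePoint.coe_eq_coe] at h4
        exact hy (h4 ▸ hH)
  · filter_upwards [hw t y] with s hs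
    exact ⟨fun h => absurd (hs.1 h.1) hty, fun h => absurd h.1 hty⟩

/-- Once x has been left, the taboo is in force for good. The exception is a departure at exactly
`s`, where the strict inequality frees time `s`; there y ∉ `H` is used. -/
theorem avoidsUntil_of_entersAt (hy : y ∉ H) (hst : s ≤ t) (hs : EntersAt w H x y s)
    (ht : EntersAt w H x y t) : AvoidsUntil (fun u => w (s + u)) H y (t - s) := by
  refine ⟨by simpa [add_tsub_cancel_of_le hst] using ht.1, fun u hu h hH huh => ?_⟩
  obtain ⟨v, hv, hvx⟩ := hs.2.1
  rcases (hv.trans (le_add_of_nonneg_right (zero_le (a := u)))).eq_or_lt with h1 | h1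
  · have : v = s := le_antisymm hv (h1 ▸ le_add_of_nonneg_right (zero_le (a := u)))
    have h2 : s + u = s := by rw [← h1, this]
    have h3 := hs.1
    simp only [h2] at huh
    rw [huh, OnePoint.coe_eq_coe] at h3
    exact hy (h3 ▸ hH)
  · exact ht.2.2 v (s + u) h1 (lt_tsub_iff_left.1 hu) hvx h hH huh

theorem EntersAt.of_avoidsUntil (hst : s ≤ t) (hs : EntersAt w H x y s)
    (ht : AvoidsUntil (fun u => w (s + u)) H y (t - s)) : EntersAt w H x y t := by
  obtain ⟨v, hv, hvx⟩ := hs.2.1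
  refine ⟨by simpa [add_tsub_cancel_of_le hst] using ht.1, ⟨v, hv.trans hst, hvx⟩,
    fun v u hvu hut hvx h hH huh => ?_⟩
  rcases lt_or_ge u s with hus | hus
  · exact hs.2.2 v u hvu hus hvx h hH huh
  · refine ht.2 (u - s) (tsub_lt_tsub_right_of_le hus hut) h hH ?_
    simpa [add_tsub_cancel_of_le hus] using huh

end Paths

/-! ### From exit and entrance times to path events -/

section Translation

variable {S Ω : Type*} {ξ : ℝ≥0 → Ω → OnePoint S} {H : Set S} {x y : S} {ω : Ω} {t : ℝ≥0}

theorem exitTime_lt_iff (h0 : ξ 0 ω = x) :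
    exitTime ξ x ω < t ↔ ∃ v < t, ξ v ω ≠ x := by
  simp only [exitTime, h0, if_true, iInf_lt_iff, ENNReal.coe_lt_coe]
  exact ⟨fun ⟨v, a, b⟩ => ⟨v, b, a⟩, fun ⟨v, a, b⟩ => ⟨v, b, a⟩⟩

/-- A path resting at x up to `t` rests a little longer, so the infimum cannot equal `t` without
being attained. -/
theorem exitTime_le_iff (h0 : ξ 0 ω = x) (hw : IsStablePath fun t => ξ t ω) :
    exitTime ξ x ω ≤ t ↔ ∃ v ≤ t, ξ v ω ≠ x := by
  constructor
  · intro h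
    by_contra! hc
    obtain ⟨c, hc', hs⟩ := (mem_nhdsGT_iff_exists_Ioo_subset).1 (hw t x)
    have hc' : t < c := hc'
    have h2 : exitTime ξ x ω < c := h.trans_lt (ENNReal.coe_lt_coe.2 hc')
    obtain ⟨v, hv, hvx⟩ := (exitTime_lt_iff h0).1 h2
    rcases le_or_gt v t with hvt | hvt
    · exact hvx (hc v hvt)
    · exact hvx ((hs ⟨hvt, hv⟩).2 (hc t le_rfl))
  · rintro ⟨v, hv, hvx⟩
    simp only [exitTime, h0, if_true]
    exact (iInf₂_le v hvx).trans (ENNReal.coe_le_coe.2 hv)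

theorem tabooTime_lt_top_iff (h0 : ξ 0 ω = x) (hw : IsStablePath fun t => ξ t ω) :
    tabooTime ξ H x y ω < ⊤ ↔ ∃ t, EntersAt (fun t => ξ t ω) H x y t := by
  simp only [tabooTime, h0, if_true, iInf_lt_iff, ENNReal.coe_lt_top, exists_prop, and_true,
    exitTime_lt_iff h0, exitTime_le_iff h0 hw, EntersAt]
  refine exists_congr fun t => ?_
  constructor
  · rintro ⟨h1, h2, h3⟩
    exact ⟨h2, h1, fun v u hvu hut hvx => h3 u ⟨v, hvu, hvx⟩ hut⟩
  · rintro ⟨h1, h2, h3⟩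
    exact ⟨h2, h1, fun u ⟨v, hvu, hvx⟩ hut => h3 v u hvu hut hvx⟩

/-- If x is not left by time `t`, the minimum is `t` and the taboo window is empty: this is the
resting alternative, which forces x = y. -/
theorem tabooEvent_iff (h0 : ξ 0 ω = x) :
    (ξ t ω = y ∧ ∀ u : ℝ≥0, min (exitTime ξ x ω) (t : ℝ≥0∞) < (u : ℝ≥0∞) → u < t →
      ∀ h ∈ H, ξ u ω ≠ (h : OnePoint S)) ↔
    EntersAt (fun t => ξ t ω) H x y t ∨ (x = y ∧ RestsUntil (fun t => ξ t ω) x t) := by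
  have hm : ∀ u : ℝ≥0, u < t →
      (min (exitTime ξ x ω) (t : ℝ≥0∞) < (u : ℝ≥0∞) ↔ ∃ v < u, ξ v ω ≠ x) := by
    intro u hu
    rw [min_lt_iff, exitTime_lt_iff h0, ENNReal.coe_lt_coe]
    exact or_iff_left hu.not_gt
  constructor
  · rintro ⟨h1, h2⟩
    by_cases hr : ∃ v ≤ t, ξ v ω ≠ x
    · exact .inl ⟨h1, hr, fun v u hvu hut hvx => h2 u ((hm u hut).2 ⟨v, hvu, hvx⟩) hut⟩
    · push Not at hr
      refine .inr ⟨?_, hr⟩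
      rw [hr t le_rfl] at h1
      exact OnePoint.coe_eq_coe.1 h1
  · rintro (⟨h1, h2, h3⟩ | ⟨rfl, h⟩)
    · refine ⟨h1, fun u hu hut => ?_⟩
      obtain ⟨v, hvu, hvx⟩ := (hm u hut).1 hu
      exact h3 v u hvu hut hvx
    · refine ⟨h t le_rfl, fun u hu hut => ?_⟩
      obtain ⟨v, hvu, hvx⟩ := (hm u hut).1 hu
      exact absurd (h v (hvu.le.trans hut.le)) hvx

theorem entersAt_or_restsUntil_iff {w : ℝ≥0 → OnePoint S} (h0 : w 0 = y) (hy : y ∉ H)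
    (hw : IsStablePath w) :
    (EntersAt w H y y t ∨ RestsUntil w y t) ↔ AvoidsUntil w H y t := by
  constructor
  · rintro (⟨h1, -, h3⟩ | h)
    · refine ⟨h1, fun u hut h hH hu => ?_⟩
      -- The visit to `H` at `u` is itself a departure from y. A taboo visit must come strictly
      -- later, so the path is caught in the same state at `e > u`.
      obtain ⟨e, -, h4, h5, h6⟩ := hw.exists_between dense_univ h hut
      refine h3 u e h4 h5 ?_ h hH (h6.2 hu)
      rw [hu, Ne, OnePoint.coe_eq_coe]
      rintro rfl
      exact hy hH
    · refine ⟨h t le_rfl, fun u hut k hH hu => ?_⟩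
      have := h u hut.le
      rw [hu, OnePoint.coe_eq_coe] at this
      exact hy (this ▸ hH)
  · rintro ⟨h1, h2⟩
    by_cases hr : ∃ v ≤ t, w v ≠ y
    · exact .inl ⟨h1, hr, fun v u _ hut _ => h2 u hut⟩
    · push Not at hr
      exact .inr hr

end Translation

/-! ### Cylinder events and the sigma-algebras they generate -/

/-- The event that the process takes prescribed values at finitely many prescribed times. -/
def cylinderEvent {S Ω : Type*} (ξ : ℝ≥0 → Ω → OnePoint S) (I : Finset (ℝ≥0 × S)) : Set Ω :=
  {ω | ∀ p ∈ I, ξ p.1 ω = (p.2 : OnePoint S)}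

/-- The `σ`-algebra generated by the process up to time `s`. -/
@[reducible]
def pastSigma {S Ω : Type*} (ξ : ℝ≥0 → Ω → OnePoint S) (s : ℝ≥0) : MeasurableSpace Ω :=
  MeasurableSpace.generateFrom {B | ∃ I, (∀ p ∈ I, p.1 ≤ s) ∧ B = cylinderEvent ξ I}

/-- The `σ`-algebra on the space of paths generated by the coordinates. -/
@[reducible]
def pathSigma (S : Type*) : MeasurableSpace (ℝ≥0 → OnePoint S) :=
  MeasurableSpace.generateFrom (range (cylinderEvent fun t (w : ℝ≥0 → OnePoint S) => w t))

section Sigma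

variable {S Ω : Type*} {ξ : ℝ≥0 → Ω → OnePoint S}

theorem cylinderEvent_union [DecidableEq (ℝ≥0 × S)] (I J : Finset (ℝ≥0 × S)) :
    cylinderEvent ξ (I ∪ J) = cylinderEvent ξ I ∩ cylinderEvent ξ J := by
  ext ω
  simp only [cylinderEvent, Finset.mem_union, or_imp, forall_and]
  rfl

theorem cylinderEvent_singleton (t : ℝ≥0) (z : S) :
    cylinderEvent ξ {(t, z)} = {ω | ξ t ω = (z : OnePoint S)} := by
  simp [cylinderEvent]

theorem measurableSet_pastSigma_cylinderEvent {s : ℝ≥0} {I : Finset (ℝ≥0 × S)}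
    (hI : ∀ p ∈ I, p.1 ≤ s) : MeasurableSet[pastSigma ξ s] (cylinderEvent ξ I) :=
  MeasurableSpace.measurableSet_generateFrom ⟨I, hI, rfl⟩

theorem measurableSet_pastSigma {s t : ℝ≥0} (hts : t ≤ s) (z : S) :
    MeasurableSet[pastSigma ξ s] {ω | ξ t ω = (z : OnePoint S)} := by
  rw [← cylinderEvent_singleton]
  exact measurableSet_pastSigma_cylinderEvent (by simpa using hts)

theorem pastSigma_mono {s t : ℝ≥0} (hst : s ≤ t) : pastSigma ξ s ≤ pastSigma ξ t := by
  refine MeasurableSpace.generateFrom_mono ?_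
  rintro _ ⟨I, hI, rfl⟩
  exact ⟨I, fun p hp => (hI p hp).trans hst, rfl⟩

theorem measurableSet_pathSigma (t : ℝ≥0) (z : S) :
    MeasurableSet[pathSigma S] {w | w t = (z : OnePoint S)} := by
  rw [← cylinderEvent_singleton (ξ := fun t (w : ℝ≥0 → OnePoint S) => w t)]
  exact MeasurableSpace.measurableSet_generateFrom (mem_range_self _)

theorem isPiSystem_past (s : ℝ≥0) :
    IsPiSystem {B | ∃ I, (∀ p ∈ I, p.1 ≤ s) ∧ B = cylinderEvent ξ I} := by
  classical
  rintro _ ⟨I, hI, rfl⟩ _ ⟨J, hJ, rfl⟩ -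
  refine ⟨I ∪ J, fun p hp => ?_, (cylinderEvent_union I J).symm⟩
  rcases Finset.mem_union.1 hp with h | h
  exacts [hI p h, hJ p h]

theorem isPiSystem_range_cylinderEvent : IsPiSystem (range (cylinderEvent ξ)) := by
  classical
  rintro _ ⟨I, rfl⟩ _ ⟨J, rfl⟩ -
  exact ⟨I ∪ J, cylinderEvent_union I J⟩

end Sigma

/-! ### The Markov property for general past and future events -/

section Markov

variable {S Ω : Type*} [TopologicalSpace S] [MeasurableSpace Ω]
  {A : S → S → ℝ} {P : S → Measure Ω} {ξ : ℝ≥0 → Ω → OnePoint S}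

theorem IsMarkovChain.measurableSet_cylinderEvent (hξ : IsMarkovChain A P ξ)
    (I : Finset (ℝ≥0 × S)) : MeasurableSet (cylinderEvent ξ I) := by
  have : cylinderEvent ξ I = ⋂ p ∈ I, {ω | ξ p.1 ω = (p.2 : OnePoint S)} := by
    ext ω
    simp [cylinderEvent]
  rw [this]
  exact Finset.measurableSet_biInter _ fun p _ => hξ.measurableSet_state _ _

theorem IsMarkovChain.pastSigma_le (hξ : IsMarkovChain A P ξ) (s : ℝ≥0) :
    pastSigma ξ s ≤ ‹MeasurableSpace Ω› := by
  refine MeasurableSpace.generateFrom_le ?_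
  rintro _ ⟨I, -, rfl⟩
  exact hξ.measurableSet_cylinderEvent I

theorem IsMarkovChain.markov_cylinderEvent (hξ : IsMarkovChain A P ξ) (x y z : S) (s r : ℝ≥0)
    (I : Finset (ℝ≥0 × S)) (hI : ∀ p ∈ I, p.1 ≤ s) (hs : (s, y) ∈ I) :
    P x (cylinderEvent ξ I ∩ {ω | ξ (s + r) ω = (z : OnePoint S)}) =
      P x (cylinderEvent ξ I) * P y {ω | ξ r ω = (z : OnePoint S)} := by
  classical
  -- A point of the event makes `I` consistent: prescriptions at equal times agree, so `I` can be
  -- listed as states along increasing times, ending at `s`.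
  rcases (cylinderEvent ξ I).eq_empty_or_nonempty with he | ⟨ω₀, hω₀⟩
  · simp [he]
  have hJ : (I.image Prod.fst).Nonempty := ⟨s, Finset.mem_image_of_mem _ hs⟩
  obtain ⟨n, hn⟩ : ∃ n, (I.image Prod.fst).card = n + 1 :=
    Nat.exists_eq_succ_of_ne_zero (Finset.card_ne_zero.2 hJ)
  set e := (I.image Prod.fst).orderEmbOfFin hn with he
  have hmem : ∀ j, ∃ z : S, (e j, z) ∈ I := by
    intro j
    obtain ⟨⟨u, z⟩, h1, h2⟩ := Finset.mem_image.1 (Finset.orderEmbOfFin_mem _ hn j)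
    exact ⟨z, by rw [← show u = e j from h2]; exact h1⟩
  choose ζ hζ using hmem
  have hlast : e (Fin.last n) = s := by
    refine le_antisymm (hI _ (hζ _)) ?_
    have : s ∈ range e := by
      rw [he, Finset.range_orderEmbOfFin]
      exact Finset.mem_coe.2 (Finset.mem_image_of_mem Prod.fst hs)
    obtain ⟨j, hj⟩ := this
    rw [← hj]
    exact e.monotone (Fin.le_last j)
  have hζlast : ζ (Fin.last n) = y := by
    have h1 := hω₀ _ (hζ (Fin.last n))
    have h2 := hω₀ _ hs
    simp only [hlast] at h1 h2
    exact OnePoint.coe_eq_coe.1 (h1.symm.trans h2)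
  have hset : cylinderEvent ξ I = {ω | ∀ j, ξ (e j) ω = (ζ j : OnePoint S)} := by
    ext ω
    refine ⟨fun h j => h _ (hζ j), fun h p hp => ?_⟩
    have : p.1 ∈ range e := by
      rw [he, Finset.range_orderEmbOfFin]
      exact Finset.mem_coe.2 (Finset.mem_image_of_mem Prod.fst hp)
    obtain ⟨j, hj⟩ := this
    rw [← hj, h j, ← hω₀ _ (hζ j), ← hω₀ _ hp, hj]
  have := hξ.markov x n e ζ r z e.monotone
  rw [← hset, hlast, hζlast] at this
  exact this

/-- For fixed states both sides are finite measures in `E`; they agree on cylinders, a π-system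
generating the past. -/
theorem IsMarkovChain.markov_past (hξ : IsMarkovChain A P ξ) (x y z : S) (s r : ℝ≥0)
    {E : Set Ω} (hE : MeasurableSet[pastSigma ξ s] E) :
    P x (E ∩ {ω | ξ s ω = (y : OnePoint S)} ∩ {ω | ξ (s + r) ω = (z : OnePoint S)}) =
      P x (E ∩ {ω | ξ s ω = (y : OnePoint S)}) * P y {ω | ξ r ω = (z : OnePoint S)} := by
  classical
  have := hξ.isProbabilityMeasure
  have hm := hξ.measurableSet_state
  set c := P y {ω | ξ r ω = (z : OnePoint S)}
  have hc : c ≠ ⊤ := measure_ne_top _ _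
  have key : ∀ I : Finset (ℝ≥0 × S), (∀ p ∈ I, p.1 ≤ s) →
      P x (cylinderEvent ξ I ∩ {ω | ξ s ω = (y : OnePoint S)} ∩
        {ω | ξ (s + r) ω = (z : OnePoint S)}) =
      P x (cylinderEvent ξ I ∩ {ω | ξ s ω = (y : OnePoint S)}) * c := by
    intro I hI
    rw [← cylinderEvent_singleton (ξ := ξ) s y, ← cylinderEvent_union]
    refine hξ.markov_cylinderEvent x y z s r _ ?_ (by simp)
    intro p hp
    rcases Finset.mem_union.1 hp with h | h
    · exact hI p h
    · rw [Finset.mem_singleton.1 h]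
  have h := ext_on_measurableSpace_of_generate_finite ‹MeasurableSpace Ω›
    (μ := (P x).restrict ({ω | ξ s ω = (y : OnePoint S)} ∩ {ω | ξ (s + r) ω = (z : OnePoint S)}))
    (ν := c • (P x).restrict {ω | ξ s ω = (y : OnePoint S)})
    {B | ∃ I, (∀ p ∈ I, p.1 ≤ s) ∧ B = cylinderEvent ξ I} ?_ (hξ.pastSigma_le s) rfl
    (isPiSystem_past s) ?_ hE
  · rw [Measure.restrict_apply (hξ.pastSigma_le s _ hE), Measure.smul_apply,
      Measure.restrict_apply (hξ.pastSigma_le s _ hE), smul_eq_mul, mul_comm, ← inter_assoc] at h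
    exact h
  · rintro _ ⟨I, hI, rfl⟩
    rw [Measure.restrict_apply (hξ.measurableSet_cylinderEvent I), Measure.smul_apply,
      Measure.restrict_apply (hξ.measurableSet_cylinderEvent I), smul_eq_mul, mul_comm,
      ← inter_assoc]
    exact key I hI
  · have := key ∅ (by simp)
    simp only [cylinderEvent, Finset.notMem_empty, false_imp_iff, implies_true, ofPred_true,
      univ_inter] at this
    simp only [Measure.restrict_apply_univ, Measure.smul_apply, smul_eq_mul]
    rw [this, mul_comm]

/-- Induction on the latest prescribed time: conditioning at the second latest time splits off the
same one-step factor on both sides. -/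
theorem IsMarkovChain.markov_future_cylinderEvent (hξ : IsMarkovChain A P ξ) (x y : S)
    (s : ℝ≥0) {E : Set Ω} (hE : MeasurableSet[pastSigma ξ s] E) (I : Finset (ℝ≥0 × S)) :
    P x (E ∩ {ω | ξ s ω = (y : OnePoint S)} ∩ cylinderEvent (fun t ω => ξ (s + t) ω) I) =
      P x (E ∩ {ω | ξ s ω = (y : OnePoint S)}) * P y (cylinderEvent ξ I) := by
  classical
  have := hξ.isProbabilityMeasure
  refine Finset.induction_on_max_value Prod.fst I ?_ fun p I _ hmax ih => ?_
  · simp [cylinderEvent]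
  · clear * - hξ hE hmax ih this
    have hsplit : ∀ η : ℝ≥0 → Ω → OnePoint S, cylinderEvent η (insert p I) =
        cylinderEvent η I ∩ {ω | η p.1 ω = (p.2 : OnePoint S)} := by
      intro η
      rw [← cylinderEvent_singleton, Finset.insert_eq, cylinderEvent_union, inter_comm]
    rw [hsplit, hsplit, ← inter_assoc]
    rcases I.eq_empty_or_nonempty with rfl | hne
    · simp only [cylinderEvent, Finset.notMem_empty, false_imp_iff, implies_true, ofPred_true,
        univ_inter, inter_univ]
      exact hξ.markov_past x y p.2 s p.1 hE
    obtain ⟨q, hqI, hq⟩ := Finset.exists_max_image I Prod.fst hne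
    have hqp : q.1 ≤ p.1 := hmax q hqI
    have hshift : MeasurableSet[pastSigma ξ (s + q.1)]
        (cylinderEvent (fun t ω => ξ (s + t) ω) I) := by
      have : cylinderEvent (fun t ω => ξ (s + t) ω) I =
          cylinderEvent ξ (I.image fun p => (s + p.1, p.2)) := by
        ext ω
        simp only [cylinderEvent, mem_ofPred_eq, Finset.forall_mem_image]
      rw [this]
      refine measurableSet_pastSigma_cylinderEvent ?_
      simp only [Finset.forall_mem_image]
      exact fun p hp => by gcongr; exact hq p hp
    have e1 : s + q.1 + (p.1 - q.1) = s + p.1 := by rw [add_assoc, add_tsub_cancel_of_le hqp]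
    have e2 : q.1 + (p.1 - q.1) = p.1 := add_tsub_cancel_of_le hqp
    have h1 := hξ.markov_past x q.2 p.2 (s + q.1) (p.1 - q.1)
      (E := E ∩ {ω | ξ s ω = (y : OnePoint S)} ∩ cylinderEvent (fun t ω => ξ (s + t) ω) I)
      (((pastSigma_mono le_self_add _ hE).inter (measurableSet_pastSigma le_self_add y)).inter
        hshift)
    have h2 := hξ.markov_past y q.2 p.2 q.1 (p.1 - q.1)
      (measurableSet_pastSigma_cylinderEvent (ξ := ξ) hq)
    have h3 : E ∩ {ω | ξ s ω = (y : OnePoint S)} ∩ cylinderEvent (fun t ω => ξ (s + t) ω) I ∩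
        {ω | ξ (s + q.1) ω = (q.2 : OnePoint S)} =
        E ∩ {ω | ξ s ω = (y : OnePoint S)} ∩ cylinderEvent (fun t ω => ξ (s + t) ω) I :=
      inter_eq_left.2 fun ω hω => hω.2 q hqI
    have h4 : cylinderEvent ξ I ∩ {ω | ξ q.1 ω = (q.2 : OnePoint S)} = cylinderEvent ξ I :=
      inter_eq_left.2 fun ω hω => hω q hqI
    rw [h3, e1] at h1
    rw [h4, e2] at h2
    rw [h1, h2, ih, mul_assoc]

/-- The Markov property: given that the chain is at `y` at time `s`, its future after `s` is
independent of its past and has the law of the chain started at `y`. -/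
theorem IsMarkovChain.markov_future (hξ : IsMarkovChain A P ξ) (x y : S) (s : ℝ≥0)
    {E : Set Ω} (hE : MeasurableSet[pastSigma ξ s] E) {G : Set (ℝ≥0 → OnePoint S)}
    (hG : MeasurableSet[pathSigma S] G) :
    P x (E ∩ {ω | ξ s ω = (y : OnePoint S)} ∩ {ω | (fun t => ξ (s + t) ω) ∈ G}) =
      P x (E ∩ {ω | ξ s ω = (y : OnePoint S)}) * P y {ω | (fun t => ξ t ω) ∈ G} := by
  have := hξ.isProbabilityMeasure
  let _ := pathSigma S
  set E' := E ∩ {ω | ξ s ω = (y : OnePoint S)} with hE'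
  have hE'm : MeasurableSet E' :=
    (hξ.pastSigma_le s _ hE).inter (hξ.measurableSet_state s y)
  have hf : ∀ s, Measurable fun ω t => ξ (s + t) ω := by
    intro s
    refine measurable_generateFrom ?_
    rintro _ ⟨I, rfl⟩
    have : (fun ω t => ξ (s + t) ω) ⁻¹' cylinderEvent (fun t (w : ℝ≥0 → OnePoint S) => w t) I =
        ⋂ p ∈ I, {ω | ξ (s + p.1) ω = (p.2 : OnePoint S)} := by
      ext ω
      simp [cylinderEvent]
    rw [this]
    exact Finset.measurableSet_biInter _ fun p _ => hξ.measurableSet_state _ _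
  have hf0 : Measurable fun ω t => ξ t ω := by simpa using hf 0
  have heq : ((P x).restrict E').map (fun ω t => ξ (s + t) ω) =
      P x E' • (P y).map (fun ω t => ξ t ω) := by
    refine ext_of_generate_finite _ rfl isPiSystem_range_cylinderEvent ?_ ?_
    · rintro _ ⟨I, rfl⟩
      have hI : MeasurableSet (cylinderEvent (fun t (w : ℝ≥0 → OnePoint S) => w t) I) :=
        MeasurableSpace.measurableSet_generateFrom (mem_range_self I)
      rw [Measure.map_apply (hf s) hI, Measure.restrict_apply (hf s hI), Measure.smul_apply,
        Measure.map_apply hf0 hI, inter_comm, smul_eq_mul]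
      exact hξ.markov_future_cylinderEvent x y s hE I
    · rw [Measure.map_apply (hf s) .univ, Measure.smul_apply, Measure.map_apply hf0 .univ]
      simp
  have h := DFunLike.congr_fun heq G
  rw [Measure.map_apply (hf s) hG, Measure.restrict_apply (hf s hG), Measure.smul_apply,
    Measure.map_apply hf0 hG, inter_comm, smul_eq_mul] at h
  exact h

end Markov

/-! ### Measurability of taboo events on stable paths -/

section Measurability

variable {S X : Type*} [Countable S] {m : MeasurableSpace X} {η : ℝ≥0 → X → OnePoint S}
  {H : Set S} {x y : S} {t : ℝ≥0}

/-- The sigma-algebra and the process are left free, so that one lemma serves the ambient space, the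
past of a time and the path space. -/
theorem exists_measurableSet_entersAt
    (hm : ∀ u ≤ t, ∀ z : S, MeasurableSet {a | η u a = (z : OnePoint S)}) :
    ∃ E, MeasurableSet E ∧ ∀ a, IsStablePath (fun u => η u a) →
      (a ∈ E ↔ EntersAt (fun u => η u a) H x y t) := by
  obtain ⟨D, hDc, hD⟩ := TopologicalSpace.exists_countable_dense ℝ≥0
  refine ⟨{a | η t a = y ∧ (η t a ≠ x ∨ ∃ v ∈ D, v < t ∧ η v a ≠ x) ∧
      ∀ v ∈ D, ∀ u ∈ D, v < u → u < t → η v a ≠ x → ∀ h ∈ H, η u a ≠ h}, ?_,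
    fun a ha => (ha.entersAt_iff hD).symm⟩
  have hrw : {a | η t a = y ∧ (η t a ≠ x ∨ ∃ v ∈ D, v < t ∧ η v a ≠ x) ∧
      ∀ v ∈ D, ∀ u ∈ D, v < u → u < t → η v a ≠ x → ∀ h ∈ H, η u a ≠ h} =
      {a | η t a = y} ∩ ({a | η t a = x}ᶜ ∪ ⋃ v ∈ D, ⋃ (_ : v < t), {a | η v a = x}ᶜ) ∩
      ⋂ v ∈ D, ⋂ u ∈ D, ⋂ (_ : v < u), ⋂ (_ : u < t),
        ({a | η v a = x} ∪ ⋂ h ∈ H, {a | η u a = (h : OnePoint S)}ᶜ) := by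
    ext a
    simp only [mem_ofPred_eq, mem_inter_iff, mem_union, mem_compl_iff, mem_iUnion, mem_iInter,
      exists_prop, and_assoc, or_iff_not_imp_left, ne_eq]
  rw [hrw]
  refine ((hm t le_rfl y).inter ((hm t le_rfl x).compl.union ?_)).inter ?_
  · exact .biUnion hDc fun v _ => .iUnion fun hv => (hm v hv.le x).compl
  · refine .biInter hDc fun v _ => .biInter hDc fun u _ => .iInter fun hvu => .iInter fun hut => ?_
    exact (hm v (hvu.le.trans hut.le) x).union
      (.biInter H.to_countable fun h _ => (hm u hut.le h).compl)

theorem exists_measurableSet_avoidsUntil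
    (hm : ∀ u ≤ t, ∀ z : S, MeasurableSet {a | η u a = (z : OnePoint S)}) :
    ∃ E, MeasurableSet E ∧ ∀ a, IsStablePath (fun u => η u a) →
      (a ∈ E ↔ AvoidsUntil (fun u => η u a) H y t) := by
  obtain ⟨D, hDc, hD⟩ := TopologicalSpace.exists_countable_dense ℝ≥0
  refine ⟨{a | η t a = y ∧ ∀ u ∈ D, u < t → ∀ h ∈ H, η u a ≠ h}, ?_,
    fun a ha => (ha.avoidsUntil_iff hD).symm⟩
  have hrw : {a | η t a = y ∧ ∀ u ∈ D, u < t → ∀ h ∈ H, η u a ≠ h} =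
      {a | η t a = y} ∩ ⋂ u ∈ D, ⋂ (_ : u < t), ⋂ h ∈ H, {a | η u a = (h : OnePoint S)}ᶜ := by
    ext a
    simp
  rw [hrw]
  exact (hm t le_rfl y).inter (.biInter hDc fun u _ => .iInter fun hut =>
    .biInter H.to_countable fun h _ => (hm u hut.le h).compl)

end Measurability

/-! ### The exponential holding time and the Markov property at an entrance -/

theorem IsStablePath.restsUntil_of_dyadic {S : Type*} {w : ℝ≥0 → OnePoint S}
    (hw : IsStablePath w) {x : S} {t : ℝ≥0} (h : ∀ m : ℕ, ∀ k ≤ 2 ^ m, w ((k : ℕ) * (t / 2 ^ m)) = x) : RestsUntil w x t := by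
  have ht : w t = x := by simpa using h 0 1 (by simp)
  intro u hut
  by_contra hu
  rcases hut.eq_or_lt with rfl | hut
  · exact hu ht
  obtain ⟨c, hc, hs⟩ := (mem_nhdsGT_iff_exists_Ioo_subset' hut).1 (hw u x)
  have hc : u < c := hc
  wlog hct : c ≤ t generalizing c
  · exact this t hut (Ioo_subset_Ioo_right (not_le.1 hct).le |>.trans hs) hut le_rfl
  have htpos : 0 < t := (zero_le (a := u)).trans_lt hut
  obtain ⟨m, hm⟩ : ∃ m : ℕ, t / 2 ^ m < c - u := by
    have hcu : 0 < c - u := tsub_pos_of_lt hc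
    obtain ⟨m, hm⟩ := pow_unbounded_of_one_lt (t / (c - u)) (one_lt_two (α := ℝ≥0))
    refine ⟨m, ?_⟩
    rw [div_lt_iff₀ hcu] at hm
    rw [div_lt_iff₀ (by positivity), mul_comm]
    exact hm
  set δ := t / 2 ^ m with hδ
  have hδpos : 0 < δ := by positivity
  have h1 : u < (⌊u / δ⌋₊ + 1 : ℕ) * δ := by
    have := Nat.lt_floor_add_one (u / δ)
    rw [div_lt_iff₀ hδpos] at this
    exact_mod_cast this
  have h2 : (⌊u / δ⌋₊ + 1 : ℕ) * δ < c := by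
    have := Nat.floor_le (zero_le (a := u / δ))
    rw [le_div_iff₀ hδpos] at this
    calc ((⌊u / δ⌋₊ + 1 : ℕ) : ℝ≥0) * δ = ⌊u / δ⌋₊ * δ + δ := by push_cast; ring
      _ < u + (c - u) := add_lt_add_of_le_of_lt this hm
      _ = c := add_tsub_cancel_of_le hc.le
  -- The first grid point strictly after `u` lies before `c`, where the path is still away from x.
  refine hu ((hs ⟨h1, h2⟩).1 (h m _ ?_))
  have h3 : ((⌊u / δ⌋₊ + 1 : ℕ) : ℝ≥0) * δ ≤ 2 ^ m * δ := by
    refine (h2.le.trans hct).trans (le_of_eq ?_)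
    rw [hδ]
    field_simp
  exact_mod_cast le_of_mul_le_mul_right h3 hδpos

section Chain

variable {S Ω : Type*} [TopologicalSpace S] [MeasurableSpace Ω]
  {A : S → S → ℝ} {P : S → Measure Ω} {ξ : ℝ≥0 → Ω → OnePoint S}

theorem IsMarkovChain.ae_isStablePath [DiscreteTopology S] (hξ : IsMarkovChain A P ξ) (x : S) :
    ∀ᵐ ω ∂P x, IsStablePath fun t => ξ t ω := by
  filter_upwards [hξ.right_continuous x] with ω hω
  exact isStablePath_of_continuousWithinAt hω

theorem IsMarkovChain.nullMeasurableSet_entersAt [Countable S] [DiscreteTopology S]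
    (hξ : IsMarkovChain A P ξ) (H : Set S) (x y z : S) (t : ℝ≥0) :
    NullMeasurableSet {ω | EntersAt (fun u => ξ u ω) H x y t} (P z) := by
  obtain ⟨E, hE, hE'⟩ := exists_measurableSet_entersAt (η := ξ) (H := H) (x := x) (y := y) (t := t)
    fun u _ z => hξ.measurableSet_state u z
  refine NullMeasurableSet.congr hE.nullMeasurableSet ?_
  filter_upwards [hξ.ae_isStablePath z] with ω hω
  exact propext (hE' ω hω)

/-- The Markov property at a time `s` at which the chain is at `y` after leaving `x` and avoiding
the taboo set. -/
theorem IsMarkovChain.measure_entersAt_entersAt [Countable S] [DiscreteTopology S]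
    (hξ : IsMarkovChain A P ξ) {H : Set S} {x y : S} (hy : y ∉ H) (z : S) {s t : ℝ≥0} (hst : s ≤ t)
    {E : Set Ω} (hE : MeasurableSet[pastSigma ξ s] E) :
    P z {ω | ω ∈ E ∧ EntersAt (fun u => ξ u ω) H x y s ∧ EntersAt (fun u => ξ u ω) H x y t} =
      P z {ω | ω ∈ E ∧ EntersAt (fun u => ξ u ω) H x y s} *
        P y {ω | AvoidsUntil (fun u => ξ u ω) H y (t - s)} := by
  obtain ⟨C, hC, hC'⟩ := exists_measurableSet_entersAt (m := pastSigma ξ s) (η := ξ) (H := H)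
    (x := x) (y := y) (t := s) fun u hu z => measurableSet_pastSigma hu z
  obtain ⟨G, hG, hG'⟩ := exists_measurableSet_avoidsUntil (m := pathSigma S)
    (η := fun u w => w u) (H := H) (y := y) (t := t - s) fun u _ z => measurableSet_pathSigma u z
  have h := hξ.markov_future z y s (hE.inter hC) hG
  convert h using 1
  · refine measure_congr ?_
    filter_upwards [hξ.ae_isStablePath z] with ω hω
    refine propext ?_
    change (ω ∈ E ∧ _ ∧ _) ↔ ((ω ∈ E ∧ ω ∈ C) ∧ ξ s ω = y) ∧ (fun t => ξ (s + t) ω) ∈ G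
    rw [hC' ω hω, hG' _ (hω.comp_add s)]
    constructor
    · rintro ⟨h1, h2, h3⟩
      exact ⟨⟨⟨h1, h2⟩, h2.1⟩, avoidsUntil_of_entersAt hy hst h2 h3⟩
    · rintro ⟨⟨⟨h1, h2⟩, -⟩, h3⟩
      exact ⟨h1, h2, h2.of_avoidsUntil hst h3⟩
  · congr 1
    · refine measure_congr ?_
      filter_upwards [hξ.ae_isStablePath z] with ω hω
      refine propext ?_
      change (ω ∈ E ∧ _) ↔ ((ω ∈ E ∧ ω ∈ C) ∧ ξ s ω = y)
      rw [hC' ω hω]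
      exact ⟨fun h => ⟨h, h.2.1⟩, fun h => h.1⟩
    · refine measure_congr ?_
      filter_upwards [hξ.ae_isStablePath y] with ω hω
      exact propext (hG' _ hω).symm

theorem IsMarkovChain.measure_forall_grid (hξ : IsMarkovChain A P ξ) (x : S) (δ : ℝ≥0) (n : ℕ) :
    P x {ω | ∀ k ≤ n, ξ (k * δ) ω = (x : OnePoint S)} =
      P x {ω | ξ δ ω = (x : OnePoint S)} ^ n := by
  have := hξ.isProbabilityMeasure
  induction n with
  | zero =>
    have : {ω | ∀ k ≤ 0, ξ ((k : ℕ) * δ) ω = (x : OnePoint S)} =ᵐ[P x] univ := by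
      filter_upwards [hξ.initial x] with ω hω
      refine propext ⟨fun _ => trivial, fun _ k hk => ?_⟩
      obtain rfl := Nat.le_zero.1 hk
      simpa using hω
    rw [measure_congr this]
    simp
  | succ n ih =>
    have hE : MeasurableSet[pastSigma ξ (n * δ)]
        {ω | ∀ k ≤ n, ξ (k * δ) ω = (x : OnePoint S)} := by
      have : {ω | ∀ k ≤ n, ξ (k * δ) ω = (x : OnePoint S)} =
          ⋂ k : ℕ, ⋂ (_ : k ≤ n), {ω | ξ (k * δ) ω = (x : OnePoint S)} := by
        ext
        simp
      rw [this]
      exact .iInter fun k => .iInter fun hk => measurableSet_pastSigma (by gcongr) x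
    have h := hξ.markov_past x x x (n * δ) δ hE
    have hsub : {ω | ∀ k ≤ n, ξ (k * δ) ω = (x : OnePoint S)} ⊆
        {ω | ξ (n * δ) ω = (x : OnePoint S)} := fun ω hω => hω n le_rfl
    rw [inter_eq_left.2 hsub, ih, ← pow_succ] at h
    rw [← h]
    congr 1
    ext ω
    simp only [mem_ofPred_eq, mem_inter_iff, Nat.le_succ_iff, or_imp, forall_and, forall_eq]
    push_cast
    rw [add_mul, one_mul]

/-- The first exit time of `x` has an exponential distribution. -/
theorem IsMarkovChain.measure_restsUntil [DiscreteTopology S] (hξ : IsMarkovChain A P ξ) (x : S)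
    (t : ℝ≥0) :
    NullMeasurableSet {ω | RestsUntil (fun u => ξ u ω) x t} (P x) ∧
    P x {ω | RestsUntil (fun u => ξ u ω) x t} = ENNReal.ofReal (Real.exp (A x x * t)) := by
  have := hξ.isProbabilityMeasure
  set B : ℕ → Set Ω := fun m => {ω | ∀ k ≤ 2 ^ m, ξ ((k : ℕ) * (t / 2 ^ m)) ω = (x : OnePoint S)}
    with hB
  have hBm : ∀ m, MeasurableSet (B m) := by
    intro m
    have : B m = ⋂ k : ℕ, ⋂ (_ : k ≤ 2 ^ m),
        {ω | ξ ((k : ℕ) * (t / 2 ^ m)) ω = (x : OnePoint S)} := by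
      ext
      simp [hB]
    rw [this]
    exact .iInter fun k => .iInter fun _ => hξ.measurableSet_state _ _
  have hanti : Antitone B := by
    refine antitone_nat_of_succ_le fun m ω hω k hk => ?_
    have := hω (k * 2) (by rw [pow_succ]; gcongr)
    convert this using 2
    push_cast
    rw [pow_succ]
    field_simp
  have hae : {ω | RestsUntil (fun u => ξ u ω) x t} =ᵐ[P x] ⋂ m, B m := by
    filter_upwards [hξ.ae_isStablePath x] with ω hω
    refine propext ⟨fun h => mem_iInter.2 fun m k hk => h _ ?_, fun h => ?_⟩
    · have : (k : ℝ≥0) ≤ 2 ^ m := by exact_mod_cast hk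
      calc (k : ℝ≥0) * (t / 2 ^ m) ≤ 2 ^ m * (t / 2 ^ m) := by gcongr
        _ = t := by field_simp
    · exact hω.restsUntil_of_dyadic fun m => mem_iInter.1 h m
  refine ⟨(MeasurableSet.iInter hBm).nullMeasurableSet.congr hae.symm, ?_⟩
  rw [measure_congr hae]
  -- For `t = 0` the mesh `t / n` is not positive, so the derivative at zero gives nothing.
  rcases eq_or_ne t 0 with rfl | ht
  · have : ⋂ m, B m =ᵐ[P x] univ := by
      filter_upwards [hξ.initial x] with ω hω
      exact propext ⟨fun _ => trivial, fun _ => mem_iInter.2 fun m k _ => by simpa using hω⟩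
    rw [measure_congr this]
    simp
  have hl1 : Tendsto (fun m => P x (B m)) atTop (𝓝 (P x (⋂ m, B m))) :=
    tendsto_measure_iInter_atTop (fun m => (hBm m).nullMeasurableSet) hanti
      ⟨0, measure_ne_top _ _⟩
  have hdiv : Tendsto (fun n : ℕ => t / n) atTop (𝓝[>] 0) := by
    refine tendsto_nhdsWithin_of_tendsto_nhds_of_eventually_within _ ?_ ?_
    · rw [← NNReal.tendsto_coe]
      push_cast
      exact tendsto_const_div_atTop_nhds_zero_nat _
    · filter_upwards [eventually_gt_atTop 0] with n hn
      have : 0 < t := pos_iff_ne_zero.2 ht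
      exact mem_Ioi.2 (by positivity)
  have hg : Tendsto (fun n : ℕ =>
      n * ((P x).real {ω | ξ (t / n) ω = (x : OnePoint S)} - 1)) atTop (𝓝 (A x x * t)) := by
    refine (((hξ.deriv_diag x).comp hdiv).mul_const (t : ℝ)).congr' ?_
    filter_upwards [eventually_gt_atTop 0] with n hn
    have : (t : ℝ) ≠ 0 := by exact_mod_cast ht
    simp only [Function.comp]
    push_cast
    field_simp
  -- The grid event has probability p(t/n)^n with n = 2^m, and n (p(t/n) - 1) → a(x,x) t.
  have hexp := (Real.tendsto_one_add_pow_exp_of_tendsto hg).comp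
    (tendsto_pow_atTop_atTop_of_one_lt (one_lt_two (α := ℕ)))
  have hl2 := (ENNReal.continuous_ofReal.tendsto _).comp hexp
  refine tendsto_nhds_unique hl1 (hl2.congr fun m => ?_)
  simp only [Function.comp, add_sub_cancel, hB]
  rw [hξ.measure_forall_grid, ENNReal.ofReal_pow measureReal_nonneg, ofReal_measureReal]
  push_cast
  rfl

theorem IsMarkovChain.lintegral_measure_restsUntil [DiscreteTopology S] (hξ : IsMarkovChain A P ξ)
    {x : S} (hx : A x x < 0) :
    ∫⁻ t in Ioi (0 : ℝ), P x {ω | RestsUntil (fun u => ξ u ω) x t.toNNReal} =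
      ENNReal.ofReal (-1 / A x x) := by
  have h : ∫⁻ t in Ioi (0 : ℝ), P x {ω | RestsUntil (fun u => ξ u ω) x t.toNNReal} =
      ∫⁻ t in Ioi (0 : ℝ), ENNReal.ofReal (Real.exp (A x x * t)) := by
    refine setLIntegral_congr_fun measurableSet_Ioi fun t ht => ?_
    simp only [(hξ.measure_restsUntil x _).2, Real.coe_toNNReal t (le_of_lt ht)]
  rw [h, ← ofReal_integral_eq_lintegral_ofReal (integrableOn_exp_mul_Ioi hx 0)
    (ae_of_all _ fun t => (Real.exp_pos _).le), integral_exp_mul_Ioi hx]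
  simp

/-- Either y has been left by time `t` or it has not; this separates the initial holding time from
the returns. -/
theorem IsMarkovChain.measure_avoidsUntil [DiscreteTopology S] (hξ : IsMarkovChain A P ξ)
    {H : Set S} {y : S} (hy : y ∉ H) (t : ℝ≥0) :
    P y {ω | AvoidsUntil (fun u => ξ u ω) H y t} =
      P y {ω | EntersAt (fun u => ξ u ω) H y y t} + P y {ω | RestsUntil (fun u => ξ u ω) y t} := by
  rw [← measure_union₀ (hξ.measure_restsUntil y t).1]
  · refine measure_congr ?_
    filter_upwards [hξ.ae_isStablePath y, hξ.initial y] with ω hω h0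
    exact propext (entersAt_or_restsUntil_iff h0 hy hω).symm
  · refine Disjoint.aedisjoint (disjoint_left.2 ?_)
    rintro ω ⟨-, ⟨v, hv, hvy⟩, -⟩ h
    exact hvy (h v hv)

end Chain

/-! ### Integrals over time -/

section Integrals

theorem measurable_measure_of_eventually_iff {Ω : Type*} [MeasurableSpace Ω] {μ : Measure Ω}
    [IsFiniteMeasure μ] {B : ℝ≥0 → Set Ω} (hB : ∀ t, NullMeasurableSet (B t) μ)
    (h : ∀ᵐ ω ∂μ, ∀ t, ∀ᶠ s in 𝓝[>] t, (ω ∈ B s ↔ ω ∈ B t)) :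
    Measurable fun t => μ (B t) := by
  -- The grid point of mesh 1/(n+1) strictly to the right of `t`: it depends on `t` only through a
  -- floor, and tends to `t` from the right.
  set a : ℕ → ℝ≥0 → ℝ≥0 := fun n t => (⌊(n + 1 : ℝ≥0) * t⌋₊ + 1 : ℕ) / (n + 1 : ℝ≥0) with ha
  have hlt : ∀ n t, t < a n t := by
    intro n t
    rw [ha]
    simp only
    rw [lt_div_iff₀ (by positivity), mul_comm]
    exact_mod_cast Nat.lt_floor_add_one ((n + 1 : ℝ≥0) * t)
  have hle : ∀ n t, a n t ≤ t + 1 / (n + 1 : ℝ≥0) := by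
    intro n t
    have h1 := Nat.floor_le (zero_le (a := (n + 1 : ℝ≥0) * t))
    rw [ha]
    simp only
    rw [div_le_iff₀ (by positivity)]
    push_cast
    calc (⌊(n + 1 : ℝ≥0) * t⌋₊ : ℝ≥0) + 1 ≤ (n + 1) * t + 1 := by gcongr
      _ = (t + 1 / (n + 1 : ℝ≥0)) * (n + 1) := by field_simp
  have hlim : ∀ t, Tendsto (fun n => a n t) atTop (𝓝[>] t) := by
    intro t
    refine tendsto_nhdsWithin_of_tendsto_nhds_of_eventually_within _ ?_
      (.of_forall fun n => hlt n t)
    have h1 : Tendsto (fun n : ℕ => t + 1 / (n + 1 : ℝ≥0)) atTop (𝓝 t) := by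
      have h2 : Tendsto (fun n : ℕ => 1 / (n + 1 : ℝ≥0)) atTop (𝓝 0) := by
        rw [← NNReal.tendsto_coe]
        push_cast
        exact tendsto_one_div_add_atTop_nhds_zero_nat
      simpa using h2.const_add t
    exact tendsto_of_tendsto_of_tendsto_of_le_of_le tendsto_const_nhds h1
      (fun n => (hlt n t).le) fun n => hle n t
  refine measurable_of_tendsto_metrizable (f := fun n t => μ (B (a n t))) (fun n => ?_)
    (tendsto_pi_nhds.2 fun t => ?_)
  · have h1 : Measurable fun k : ℕ => μ (B ((k + 1 : ℕ) / (n + 1 : ℝ≥0))) := measurable_from_nat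
    exact h1.comp (Nat.measurable_floor.comp (measurable_const.mul measurable_id))
  · rw [← measure_toMeasurable (B t)]
    simp_rw [fun n => (measure_toMeasurable (μ := μ) (B (a n t))).symm]
    refine tendsto_measure_of_ae_tendsto_indicator_of_isFiniteMeasure _
      (measurableSet_toMeasurable _ _) (fun n => measurableSet_toMeasurable _ _) ?_
    filter_upwards [h, (hB t).toMeasurable_ae_eq.mem_iff,
      ae_all_iff.2 fun n => (hB (a n t)).toMeasurable_ae_eq.mem_iff] with ω h1 h2 h3
    filter_upwards [(hlim t).eventually (h1 t)] with n hn
    rw [h2, h3, hn]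

theorem lintegral_shift (u : ℝ≥0) (g : ℝ≥0 → ℝ≥0∞) :
    ∫⁻ t in Ioi (0 : ℝ), (if u ≤ t.toNNReal then g (t.toNNReal - u) else 0) =
      ∫⁻ t in Ioi (0 : ℝ), g t.toNNReal := by
  rw [← lintegral_indicator measurableSet_Ioi, ← lintegral_indicator measurableSet_Ioi,
    ← lintegral_sub_right_eq_self ((Ioi (0 : ℝ)).indicator fun t => g t.toNNReal) (u : ℝ)]
  refine lintegral_congr_ae ?_
  -- At `t = u` the left integrand is `g 0`, while the shifted indicator vanishes.
  filter_upwards [compl_mem_ae_iff.2 (measure_singleton (u : ℝ))] with t ht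
  have ht : t ≠ u := ht
  rcases lt_or_gt_of_ne ht with h | h
  · have h1 : t - u ∉ Ioi (0 : ℝ) := by simpa using h.le
    rw [indicator_of_notMem h1]
    by_cases h0 : t ∈ Ioi (0 : ℝ)
    · rw [indicator_of_mem h0, if_neg]
      rw [not_le, Real.toNNReal_lt_iff_lt_coe (le_of_lt h0)]
      exact h
    · rw [indicator_of_notMem h0]
  · have h1 : t - u ∈ Ioi (0 : ℝ) := by simpa using h
    have h0 : t ∈ Ioi (0 : ℝ) := u.coe_nonneg.trans_lt h
    have h2 : u ≤ t.toNNReal := by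
      rw [Real.le_toNNReal_iff_coe_le (le_of_lt h0)]
      exact h.le
    rw [indicator_of_mem h1, indicator_of_mem h0, if_pos h2]
    congr 1
    rw [← NNReal.coe_inj, NNReal.coe_sub h2, Real.coe_toNNReal _ (le_of_lt h0),
      Real.coe_toNNReal _ (le_of_lt h1)]

/-- The half-line is folded onto one period [0, s). -/
theorem lintegral_le_of_tsum_le {f : ℝ≥0 → ℝ≥0∞} (hf : Measurable f) {s : ℝ≥0} (hs : 0 < s)
    {c : ℝ≥0∞} (hc : ∀ u, ∑' k : ℕ, f (u + k * s) ≤ c) :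
    ∫⁻ t in Ioi (0 : ℝ), f t.toNNReal ≤ c * s := by
  have hs' : (0 : ℝ) < s := hs
  have hcover : Ioi (0 : ℝ) ⊆ ⋃ k : ℕ, Ico (k * s : ℝ) ((k + 1) * s) := by
    intro t ht
    have ht : 0 < t := ht
    refine mem_iUnion.2 ⟨⌊t / s⌋₊, ?_, ?_⟩
    · have := Nat.floor_le (div_nonneg ht.le hs'.le)
      rwa [le_div_iff₀ hs'] at this
    · have := Nat.lt_floor_add_one (t / s)
      rwa [div_lt_iff₀ hs'] at this
  have hpiece : ∀ k : ℕ, ∫⁻ t in Ico (k * s : ℝ) ((k + 1) * s), f t.toNNReal =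
      ∫⁻ t in Ico (0 : ℝ) s, f (t.toNNReal + k * s) := by
    intro k
    rw [← lintegral_indicator measurableSet_Ico, ← lintegral_indicator measurableSet_Ico,
      ← lintegral_add_right_eq_self _ (k * s : ℝ)]
    refine lintegral_congr fun t => ?_
    by_cases ht : t ∈ Ico (0 : ℝ) s
    · have h1 : t + k * s ∈ Ico (k * s : ℝ) ((k + 1) * s) := by
        constructor <;> nlinarith [ht.1, ht.2]
      rw [indicator_of_mem h1, indicator_of_mem ht, Real.toNNReal_add ht.1 (by positivity)]
      congr 2
      rw [← NNReal.coe_inj, Real.coe_toNNReal _ (by positivity)]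
      push_cast
      rfl
    · have h1 : t + k * s ∉ Ico (k * s : ℝ) ((k + 1) * s) := by
        rintro ⟨h1, h2⟩
        exact ht ⟨by linarith, by linarith⟩
      rw [indicator_of_notMem h1, indicator_of_notMem ht]
  calc ∫⁻ t in Ioi (0 : ℝ), f t.toNNReal
      ≤ ∫⁻ t in ⋃ k : ℕ, Ico (k * s : ℝ) ((k + 1) * s), f t.toNNReal :=
        lintegral_mono_set hcover
    _ ≤ ∑' k : ℕ, ∫⁻ t in Ico (k * s : ℝ) ((k + 1) * s), f t.toNNReal := lintegral_iUnion_le _ _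
    _ = ∫⁻ t in Ico (0 : ℝ) s, ∑' k : ℕ, f (t.toNNReal + k * s) := by
        simp_rw [hpiece]
        rw [lintegral_tsum]
        intro k
        exact (hf.comp (measurable_real_toNNReal.add_const _)).aemeasurable
    _ ≤ ∫⁻ _ in Ico (0 : ℝ) s, c := lintegral_mono fun t => hc _
    _ = c * s := by simp

end Integrals

/-! ### Finiteness and factorization of the mean occupation time -/

section Chain

variable {S Ω : Type*} [Countable S] [TopologicalSpace S] [DiscreteTopology S] [MeasurableSpace Ω]
  {A : S → S → ℝ} {P : S → Measure Ω} {ξ : ℝ≥0 → Ω → OnePoint S} {H : Set S} {y : S}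

theorem IsMarkovChain.measurable_measure_entersAt (hξ : IsMarkovChain A P ξ) (hy : y ∉ H) (x : S) :
    Measurable fun t => P x {ω | EntersAt (fun u => ξ u ω) H x y t} := by
  have := hξ.isProbabilityMeasure
  refine measurable_measure_of_eventually_iff (hξ.nullMeasurableSet_entersAt H x y x) ?_
  filter_upwards [hξ.ae_isStablePath x] with ω hω t
  exact hω.eventually_entersAt_iff hy t

theorem IsMarkovChain.measurable_measure_avoidsUntil (hξ : IsMarkovChain A P ξ) (hy : y ∉ H) :
    Measurable fun t => P y {ω | AvoidsUntil (fun u => ξ u ω) H y t} := by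
  simp_rw [hξ.measure_avoidsUntil hy, (hξ.measure_restsUntil y _).2]
  exact (hξ.measurable_measure_entersAt hy y).add (by fun_prop)

/-- The events "at y under taboo at time u + ks, at h ∈ `H` a time s later" are disjoint in k, since
the visit to h bars later entrances. By the Markov property their probabilities carry the factor
`q`, so those at y sum to at most 1/q. -/
theorem IsMarkovChain.lintegral_measure_entersAt_lt_top (hξ : IsMarkovChain A P ξ)
    (hirr : IsIrreducible P ξ) (hH : H.Nonempty) (hy : y ∉ H) (x : S) :
    ∫⁻ t in Ioi (0 : ℝ), P x {ω | EntersAt (fun u => ξ u ω) H x y t.toNNReal} < ⊤ := by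
  have := hξ.isProbabilityMeasure
  obtain ⟨h, hh⟩ := hH
  have hyh : y ≠ h := fun e => hy (e ▸ hh)
  obtain ⟨s, hq⟩ := hirr y h
  have hs : 0 < s := by
    refine pos_iff_ne_zero.2 fun hs => hq.ne' ?_
    rw [hs]
    refine measure_mono_null ?_ (ae_iff.1 (hξ.initial y))
    intro ω hω hω'
    rw [mem_ofPred_eq, hω', OnePoint.coe_eq_coe] at hω
    exact hyh hω
  set q := P y {ω | ξ s ω = (h : OnePoint S)}
  have hqtop : q ≠ ⊤ := measure_ne_top _ _
  have hmark : ∀ t, P x {ω | EntersAt (fun u => ξ u ω) H x y t ∧ ξ (t + s) ω = h} =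
      P x {ω | EntersAt (fun u => ξ u ω) H x y t} * q := by
    intro t
    obtain ⟨E, hE, hE'⟩ := exists_measurableSet_entersAt (m := pastSigma ξ t) (η := ξ) (H := H)
      (x := x) (y := y) (t := t) fun u hu z => measurableSet_pastSigma hu z
    have h1 := hξ.markov_past x y h t s hE
    convert h1 using 1
    · refine measure_congr ?_
      filter_upwards [hξ.ae_isStablePath x] with ω hω
      refine propext ?_
      change (_ ∧ _) ↔ (ω ∈ E ∧ ξ t ω = y) ∧ ξ (t + s) ω = h
      rw [hE' ω hω]
      exact ⟨fun h => ⟨⟨h.1, h.1.1⟩, h.2⟩, fun h => ⟨h.1.1, h.2⟩⟩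
    · congr 1
      refine measure_congr ?_
      filter_upwards [hξ.ae_isStablePath x] with ω hω
      refine propext ?_
      change _ ↔ (ω ∈ E ∧ ξ t ω = y)
      rw [hE' ω hω]
      exact ⟨fun h => ⟨h, h.1⟩, fun h => h.1⟩
  have hsum : ∀ u, ∑' k : ℕ, P x {ω | EntersAt (fun u => ξ u ω) H x y (u + k * s)} ≤ q⁻¹ := by
    intro u
    rw [ENNReal.le_inv_iff_mul_le, ← ENNReal.tsum_mul_right]
    simp_rw [← hmark]
    refine (tsum_measure_le_measure_univ (μ := P x) (fun k => ?_) ?_).trans prob_le_one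
    · exact (hξ.nullMeasurableSet_entersAt H x y x _).inter
        (hξ.measurableSet_state _ h).nullMeasurableSet
    · have hdis : ∀ j k : ℕ, j < k →
          Disjoint {ω | EntersAt (fun u => ξ u ω) H x y (u + j * s) ∧ ξ (u + j * s + s) ω = h}
            {ω | EntersAt (fun u => ξ u ω) H x y (u + k * s) ∧ ξ (u + k * s + s) ω = h} := by
        intro j k hjk
        refine disjoint_left.2 ?_
        rintro ω ⟨h1, h2⟩ ⟨h3, -⟩
        obtain ⟨v, hv, hvx⟩ := h1.2.1
        have hle : u + j * s + s ≤ u + k * s := by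
          have : ((j + 1 : ℕ) : ℝ≥0) ≤ k := by exact_mod_cast hjk
          calc u + j * s + s = u + (j + 1 : ℕ) * s := by push_cast; ring
            _ ≤ u + k * s := by gcongr
        -- For consecutive indices the visit to `h` falls on the next time at y itself, and `y ≠ h`
        -- is needed instead of the taboo.
        rcases hle.eq_or_lt with he | hlt
        · rw [he] at h2
          have := h3.1
          simp only [h2, OnePoint.coe_eq_coe] at this
          exact hyh this.symm
        · exact h3.2.2 v _ (hv.trans_lt (lt_add_of_pos_right _ hs)) hlt hvx h hh h2
      intro j k hjk
      rcases lt_or_gt_of_ne hjk with hlt | hlt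
      · exact (hdis j k hlt).aedisjoint
      · exact (hdis k j hlt).symm.aedisjoint
  refine (lintegral_le_of_tsum_le (hξ.measurable_measure_entersAt hy x) hs hsum).trans_lt ?_
  exact ENNReal.mul_lt_top (ENNReal.inv_lt_top.2 hq) ENNReal.coe_lt_top

/-- Times are added in increasing order. A new largest time contributes only the paths first caught
entering there, whose occupation from then on is that of the chain started at y. -/
theorem IsMarkovChain.lintegral_measure_entersAt_finset (hξ : IsMarkovChain A P ξ) (hy : y ∉ H)
    (x : S) (I : Finset ℝ≥0) :
    Measurable (fun t : ℝ => P x {ω | (∃ u ∈ I, u ≤ t.toNNReal ∧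
      EntersAt (fun u => ξ u ω) H x y u) ∧ EntersAt (fun u => ξ u ω) H x y t.toNNReal}) ∧
    ∫⁻ t in Ioi (0 : ℝ), P x {ω | (∃ u ∈ I, u ≤ t.toNNReal ∧
      EntersAt (fun u => ξ u ω) H x y u) ∧ EntersAt (fun u => ξ u ω) H x y t.toNNReal} =
    P x {ω | ∃ u ∈ I, EntersAt (fun u => ξ u ω) H x y u} *
      ∫⁻ t in Ioi (0 : ℝ), P y {ω | AvoidsUntil (fun u => ξ u ω) H y t.toNNReal} := by
  classical
  have := hξ.isProbabilityMeasure
  have hnull := hξ.nullMeasurableSet_entersAt H x y x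
  induction I using Finset.induction_on_max with
  | empty => simp
  | insert m I hmax ih =>
    set K := ∫⁻ t in Ioi (0 : ℝ), P y {ω | AvoidsUntil (fun u => ξ u ω) H y t.toNNReal}
    set c := P x {ω | (¬ ∃ u ∈ I, EntersAt (fun u => ξ u ω) H x y u) ∧
      EntersAt (fun u => ξ u ω) H x y m} with hc
    have hIex : NullMeasurableSet {ω | ∃ u ∈ I, EntersAt (fun u => ξ u ω) H x y u} (P x) := by
      have : {ω | ∃ u ∈ I, EntersAt (fun u => ξ u ω) H x y u} =
          ⋃ u ∈ I, {ω | EntersAt (fun u => ξ u ω) H x y u} := by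
        ext
        simp
      rw [this]
      exact .biUnion I.countable_toSet fun u _ => hnull u
    have hfirst : NullMeasurableSet {ω | (¬ ∃ u ∈ I, EntersAt (fun u => ξ u ω) H x y u) ∧
        EntersAt (fun u => ξ u ω) H x y m} (P x) := hIex.compl.inter (hnull m)
    have hmark : ∀ t, m ≤ t → P x {ω | (¬ ∃ u ∈ I, EntersAt (fun u => ξ u ω) H x y u) ∧
        EntersAt (fun u => ξ u ω) H x y m ∧ EntersAt (fun u => ξ u ω) H x y t} =
        c * P y {ω | AvoidsUntil (fun u => ξ u ω) H y (t - m)} := by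
      intro t hmt
      -- All times in `I` precede `m`, so having entered at none of them is an event of the past of
      -- `m`.
      have hex : ∀ u, ∃ E, u ∈ I → MeasurableSet[pastSigma ξ m] E ∧ ∀ ω,
          IsStablePath (fun t => ξ t ω) → (ω ∈ E ↔ EntersAt (fun t => ξ t ω) H x y u) := by
        intro u
        by_cases hu : u ∈ I
        · obtain ⟨E, hE⟩ := exists_measurableSet_entersAt (m := pastSigma ξ m) (η := ξ) (H := H)
            (x := x) (y := y) (t := u)
            fun v hv z => measurableSet_pastSigma (hv.trans (hmax u hu).le) z
          exact ⟨E, fun _ => hE⟩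
        · exact ⟨∅, fun h => absurd h hu⟩
      choose E hE using hex
      have hEI : MeasurableSet[pastSigma ξ m] (⋃ u ∈ I, E u)ᶜ :=
        (MeasurableSet.biUnion I.countable_toSet fun u hu => (hE u hu).1).compl
      have hiff : ∀ ω, IsStablePath (fun t => ξ t ω) → (ω ∈ (⋃ u ∈ I, E u)ᶜ ↔
          ¬ ∃ u ∈ I, EntersAt (fun u => ξ u ω) H x y u) := by
        intro ω hω
        simp only [mem_compl_iff, mem_iUnion, exists_prop]
        exact not_congr (exists_congr fun u => and_congr_right fun hu => (hE u hu).2 ω hω)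
      have h := hξ.measure_entersAt_entersAt (H := H) (x := x) hy x hmt hEI
      rw [hc]
      convert h using 1
      · refine measure_congr ?_
        filter_upwards [hξ.ae_isStablePath x] with ω hω
        exact propext (and_congr_left fun _ => (hiff ω hω).symm)
      · congr 1
        refine measure_congr ?_
        filter_upwards [hξ.ae_isStablePath x] with ω hω
        exact propext (and_congr_left fun _ => (hiff ω hω).symm)
    have hsplit : ∀ t, P x {ω | (∃ u ∈ insert m I, u ≤ t ∧ EntersAt (fun u => ξ u ω) H x y u) ∧
        EntersAt (fun u => ξ u ω) H x y t} =
        P x {ω | (∃ u ∈ I, u ≤ t ∧ EntersAt (fun u => ξ u ω) H x y u) ∧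
          EntersAt (fun u => ξ u ω) H x y t} +
        if m ≤ t then c * P y {ω | AvoidsUntil (fun u => ξ u ω) H y (t - m)} else 0 := by
      intro t
      by_cases hmt : m ≤ t
      · rw [if_pos hmt, ← hmark t hmt, ← measure_union₀]
        · congr 1
          ext ω
          simp only [Finset.mem_insert, exists_eq_or_imp, mem_ofPred_eq, mem_union]
          constructor
          · rintro ⟨h1, h2⟩
            by_cases hI : ∃ u ∈ I, EntersAt (fun u => ξ u ω) H x y u
            · obtain ⟨u, hu, hu'⟩ := hI
              exact .inl ⟨⟨u, hu, (hmax u hu).le.trans hmt, hu'⟩, h2⟩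
            · rcases h1 with h1 | ⟨u, hu, -, hu'⟩
              · exact .inr ⟨hI, h1.2, h2⟩
              · exact absurd ⟨u, hu, hu'⟩ hI
          · rintro (⟨h1, h2⟩ | ⟨-, h1, h2⟩)
            · exact ⟨.inr h1, h2⟩
            · exact ⟨.inl ⟨hmt, h1⟩, h2⟩
        · exact hIex.compl.inter ((hnull m).inter (hnull t))
        · refine Disjoint.aedisjoint (disjoint_left.2 ?_)
          rintro ω ⟨⟨u, hu, -, hu'⟩, -⟩ ⟨h, -⟩
          exact h ⟨u, hu, hu'⟩
      · rw [if_neg hmt, add_zero]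
        simp [hmt]
    have hmeas : Measurable fun t : ℝ => if m ≤ t.toNNReal then
        c * P y {ω | AvoidsUntil (fun u => ξ u ω) H y (t.toNNReal - m)} else 0 := by
      refine Measurable.ite (measurableSet_le measurable_const measurable_real_toNNReal) ?_
        measurable_const
      exact ((hξ.measurable_measure_avoidsUntil hy).comp
        (measurable_real_toNNReal.sub_const m)).const_mul c
    have hmeas' : Measurable fun t : ℝ => P y {ω | AvoidsUntil (fun u => ξ u ω) H y t.toNNReal} :=
      (hξ.measurable_measure_avoidsUntil hy).comp measurable_real_toNNReal
    simp_rw [hsplit]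
    refine ⟨ih.1.add hmeas, ?_⟩
    rw [lintegral_add_right _ hmeas, ih.2,
      lintegral_shift m fun t => c * P y {ω | AvoidsUntil (fun u => ξ u ω) H y t},
      lintegral_const_mul _ hmeas', ← add_mul, hc, ← measure_union₀ hfirst]
    · congr 2
      ext ω
      simp only [Finset.mem_insert, exists_eq_or_imp, mem_ofPred_eq, mem_union]
      rw [or_and_left, and_iff_right (em _), or_comm]
    · refine Disjoint.aedisjoint (disjoint_left.2 ?_)
      rintro ω h ⟨h', -⟩
      exact h' h

/-- The occupation time of `y` under taboo, after leaving `x`, has mean the probability of ever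
entering `y` times the mean occupation time of `y` for the chain started at `y`. -/
theorem IsMarkovChain.lintegral_measure_entersAt (hξ : IsMarkovChain A P ξ) (hy : y ∉ H) (x : S) :
    ∫⁻ t in Ioi (0 : ℝ), P x {ω | EntersAt (fun u => ξ u ω) H x y t.toNNReal} =
    P x {ω | ∃ t, EntersAt (fun u => ξ u ω) H x y t} *
      ∫⁻ t in Ioi (0 : ℝ), P y {ω | AvoidsUntil (fun u => ξ u ω) H y t.toNNReal} := by
  classical
  have := hξ.isProbabilityMeasure
  have hnull := hξ.nullMeasurableSet_entersAt H x y x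
  set d := TopologicalSpace.denseSeq ℝ≥0
  have hdense : ∀ {ω}, IsStablePath (fun u => ξ u ω) → ∀ {t b}, t < b →
      EntersAt (fun u => ξ u ω) H x y t → ∃ k, d k < b ∧ EntersAt (fun u => ξ u ω) H x y (d k) := by
    intro ω hω t b htb ht
    obtain ⟨c, hc, hs⟩ := (mem_nhdsGT_iff_exists_Ioo_subset' htb).1
      (hω.eventually_entersAt_iff (x := x) hy t)
    obtain ⟨_, ⟨k, rfl⟩, h1, h2⟩ :=
      (TopologicalSpace.denseRange_denseSeq ℝ≥0).exists_between (lt_min hc htb)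
    exact ⟨k, h2.trans_le (min_le_right _ _), (hs ⟨h1, h2.trans_le (min_le_left _ _)⟩).2 ht⟩
  have hlhs : ∀ᵐ t ∂volume.restrict (Ioi (0 : ℝ)), P x {ω | EntersAt (fun u => ξ u ω) H x y t.toNNReal} =
      ⨆ n, P x {ω | (∃ u ∈ (Finset.range n).image d, u ≤ t.toNNReal ∧
        EntersAt (fun u => ξ u ω) H x y u) ∧ EntersAt (fun u => ξ u ω) H x y t.toNNReal} := by
    -- The loss at time `t`: entrance holds at `t` but at no dense time up to `t`. Entrance at an
    -- earlier time persists to a dense time before `t`, so these events are almost disjoint and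
    -- only countably many have positive probability.
    set B : ℝ≥0 → Set Ω := fun t => {ω | (¬ ∃ k, d k ≤ t ∧ EntersAt (fun u => ξ u ω) H x y (d k)) ∧
      EntersAt (fun u => ξ u ω) H x y t} with hB
    have hBm : ∀ t, NullMeasurableSet (B t) (P x) := by
      intro t
      have : B t = (⋃ k, ⋃ (_ : d k ≤ t), {ω | EntersAt (fun u => ξ u ω) H x y (d k)})ᶜ ∩
          {ω | EntersAt (fun u => ξ u ω) H x y t} := by
        ext
        simp [hB]
      rw [this]
      exact (NullMeasurableSet.iUnion fun k => .iUnion fun _ => hnull _).compl.inter (hnull t)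
    have hcount : {t | 0 < P x (B t)}.Countable := by
      have hlt : ∀ s t, s < t → AEDisjoint (P x) (B s) (B t) := by
        intro s t hst
        refine measure_mono_null ?_ (ae_iff.1 (hξ.ae_isStablePath x))
        rintro ω ⟨h1, h2⟩ hω
        obtain ⟨k, hk, hk'⟩ := hdense hω hst h1.2
        exact h2.1 ⟨k, hk.le, hk'⟩
      refine Measure.countable_meas_pos_of_disjoint_iUnion₀ hBm fun s t hst => ?_
      rcases lt_or_gt_of_ne hst with h | h
      · exact hlt s t h
      · exact (hlt t s h).symm
    have hnullset : volume ((fun t : ℝ≥0 => (t : ℝ)) '' {t | 0 < P x (B t)}) = 0 :=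
      (hcount.image _).measure_zero _
    filter_upwards [ae_restrict_of_ae (compl_mem_ae_iff.2 hnullset),
      ae_restrict_mem measurableSet_Ioi] with t ht ht0
    have hBt : P x (B t.toNNReal) = 0 := by
      by_contra h
      exact ht ⟨t.toNNReal, pos_iff_ne_zero.2 h, Real.coe_toNNReal t (le_of_lt ht0)⟩
    rw [← Monotone.measure_iUnion]
    · refine measure_congr ?_
      filter_upwards [measure_eq_zero_iff_ae_notMem.1 hBt] with ω hω
      refine propext ?_
      change _ ↔ ω ∈ ⋃ n, _
      simp only [mem_iUnion, mem_ofPred_eq, Finset.mem_image, Finset.mem_range,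
        exists_exists_and_eq_and]
      constructor
      · intro h
        by_contra hc
        refine hω ⟨?_, h⟩
        rintro ⟨k, hk, hk'⟩
        exact hc ⟨k + 1, ⟨k, k.lt_succ_self, hk, hk'⟩, h⟩
      · rintro ⟨n, -, h⟩
        exact h
    · rintro i j hij ω ⟨⟨u, hu, hu'⟩, h⟩
      exact ⟨⟨u, Finset.image_subset_image (Finset.range_mono hij) hu, hu'⟩, h⟩
  have hrhs : P x {ω | ∃ t, EntersAt (fun u => ξ u ω) H x y t} =
      ⨆ n, P x {ω | ∃ u ∈ (Finset.range n).image d, EntersAt (fun u => ξ u ω) H x y u} := by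
    rw [← Monotone.measure_iUnion]
    · refine measure_congr ?_
      filter_upwards [hξ.ae_isStablePath x] with ω hω
      refine propext ?_
      change _ ↔ ω ∈ ⋃ n, _
      simp only [mem_iUnion, mem_ofPred_eq, Finset.mem_image, Finset.mem_range,
        exists_exists_and_eq_and]
      constructor
      · rintro ⟨t, ht⟩
        obtain ⟨k, -, hk⟩ := hdense hω (lt_add_one t) ht
        exact ⟨k + 1, k, k.lt_succ_self, hk⟩
      · rintro ⟨n, k, -, hk⟩
        exact ⟨_, hk⟩
    · rintro i j hij ω ⟨u, hu, hu'⟩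
      exact ⟨u, Finset.image_subset_image (Finset.range_mono hij) hu, hu'⟩
  rw [lintegral_congr_ae hlhs, lintegral_iSup, hrhs, ENNReal.iSup_mul]
  · exact iSup_congr fun n => (hξ.lintegral_measure_entersAt_finset hy x _).2
  · exact fun n => (hξ.lintegral_measure_entersAt_finset hy x _).1
  · rintro i j hij t
    refine measure_mono ?_
    rintro ω ⟨⟨u, hu, hu'⟩, h⟩
    exact ⟨⟨u, Finset.image_subset_image (Finset.range_mono hij) hu, hu'⟩, h⟩

end Chain

/-! ### The taboo Green function and hitting probability -/

section Taboo

variable {S Ω : Type*} [TopologicalSpace S] [MeasurableSpace Ω]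
  {A : S → S → ℝ} {P : S → Measure Ω} {ξ : ℝ≥0 → Ω → OnePoint S} {H : Set S} {x y : S}

theorem IsMarkovChain.tabooProb_eq_of_ne (hξ : IsMarkovChain A P ξ) (hxy : x ≠ y) (t : ℝ≥0) :
    tabooProb P ξ H x y t = P x {ω | EntersAt (fun u => ξ u ω) H x y t} := by
  refine measure_congr ?_
  filter_upwards [hξ.initial x] with ω h0
  exact propext ((tabooEvent_iff h0).trans (or_iff_left fun h => hxy h.1))

variable [DiscreteTopology S]

theorem IsMarkovChain.tabooHitProb_eq (hξ : IsMarkovChain A P ξ) :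
    tabooHitProb P ξ H x y = (P x).real {ω | ∃ t, EntersAt (fun u => ξ u ω) H x y t} := by
  refine measureReal_congr ?_
  filter_upwards [hξ.ae_isStablePath x, hξ.initial x] with ω hω h0
  exact propext (tabooTime_lt_top_iff h0 hω)

theorem IsMarkovChain.tabooProb_self (hξ : IsMarkovChain A P ξ) (hy : y ∉ H) (t : ℝ≥0) :
    tabooProb P ξ H y y t = P y {ω | AvoidsUntil (fun u => ξ u ω) H y t} := by
  refine measure_congr ?_
  filter_upwards [hξ.ae_isStablePath y, hξ.initial y] with ω hω h0
  refine propext ((tabooEvent_iff h0).trans ?_)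
  rw [and_iff_right rfl]
  exact entersAt_or_restsUntil_iff h0 hy hω

variable [Countable S]

theorem IsMarkovChain.tabooGreen_eq_of_ne (hξ : IsMarkovChain A P ξ) (hy : y ∉ H) (hxy : x ≠ y) :
    tabooGreen P ξ H x y =
      P x {ω | ∃ t, EntersAt (fun u => ξ u ω) H x y t} * tabooGreen P ξ H y y := by
  simp only [tabooGreen, hξ.tabooProb_eq_of_ne hxy, hξ.tabooProb_self hy]
  exact hξ.lintegral_measure_entersAt hy x

theorem IsMarkovChain.tabooGreen_self_eq_lintegral_add (hξ : IsMarkovChain A P ξ) (hy : y ∉ H)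
    (hA : A y y < 0) :
    tabooGreen P ξ H y y =
      (∫⁻ t in Ioi (0 : ℝ), P y {ω | EntersAt (fun u => ξ u ω) H y y t.toNNReal}) +
        ENNReal.ofReal (-1 / A y y) := by
  have hm : Measurable fun t : ℝ => P y {ω | EntersAt (fun u => ξ u ω) H y y t.toNNReal} :=
    (hξ.measurable_measure_entersAt hy y).comp measurable_real_toNNReal
  simp only [tabooGreen, hξ.tabooProb_self hy, hξ.measure_avoidsUntil hy]
  rw [lintegral_add_left hm, hξ.lintegral_measure_restsUntil hA]

/-- The renewal equation at y: an initial stay, then, after a return, a fresh copy of the whole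
occupation time. -/
theorem IsMarkovChain.tabooGreen_self (hξ : IsMarkovChain A P ξ) (hy : y ∉ H) (hA : A y y < 0) :
    tabooGreen P ξ H y y =
      P y {ω | ∃ t, EntersAt (fun u => ξ u ω) H y y t} * tabooGreen P ξ H y y +
        ENNReal.ofReal (-1 / A y y) := by
  conv_lhs => rw [hξ.tabooGreen_self_eq_lintegral_add hy hA, hξ.lintegral_measure_entersAt hy y]
  simp only [tabooGreen, hξ.tabooProb_self hy]

theorem IsMarkovChain.tabooGreen_self_pos (hξ : IsMarkovChain A P ξ) (hy : y ∉ H)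
    (hA : A y y < 0) : 0 < tabooGreen P ξ H y y := by
  rw [hξ.tabooGreen_self_eq_lintegral_add hy hA]
  have : 0 < ENNReal.ofReal (-1 / A y y) :=
    ENNReal.ofReal_pos.2 (div_pos_of_neg_of_neg (by norm_num) hA)
  exact this.trans_le le_add_self

theorem IsMarkovChain.tabooGreen_lt_top (hξ : IsMarkovChain A P ξ) (hirr : IsIrreducible P ξ)
    (hH : H.Nonempty) (hy : y ∉ H) (hA : A y y < 0) : tabooGreen P ξ H x y < ⊤ := by
  have h := hξ.lintegral_measure_entersAt_lt_top hirr hH hy x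
  rcases eq_or_ne x y with rfl | hxy
  · rw [hξ.tabooGreen_self_eq_lintegral_add hy hA]
    exact ENNReal.add_lt_top.2 ⟨h, ENNReal.ofReal_lt_top⟩
  · simpa only [tabooGreen, hξ.tabooProb_eq_of_ne hxy] using h

end Taboo

end TabooChain

/-! ### The main theorem -/

theorem theorem1 {S Ω : Type*} [Countable S] [TopologicalSpace S] [DiscreteTopology S]
    [MeasurableSpace Ω] (A : S → S → ℝ) (hA : TabooChain.IsConservativeQMatrix A)
    (P : S → Measure Ω) (ξ : ℝ≥0 → Ω → OnePoint S)
    (hξ : TabooChain.IsMarkovChain A P ξ) (hirr : TabooChain.IsIrreducible P ξ)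
    (H : Set S) (hH : H.Nonempty) (x y : S) (hy : y ∉ H) :
    TabooChain.tabooGreen P ξ H x y < ⊤ ∧
    0 < TabooChain.tabooGreen P ξ H y y ∧
    TabooChain.tabooGreen P ξ H y y < ⊤ ∧
    (x ≠ y → TabooChain.tabooHitProb P ξ H x y =
      (TabooChain.tabooGreen P ξ H x y).toReal / (TabooChain.tabooGreen P ξ H y y).toReal) ∧
    (x ∉ H →
      TabooChain.tabooHitProb P ξ H x x =
        1 + 1 / (A x x * (TabooChain.tabooGreen P ξ H x x).toReal) ∧
      TabooChain.tabooHitProb P ξ H x x ∈ Set.Ico (0 : ℝ) 1) := by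
  have := hξ.isProbabilityMeasure
  have hpos : ∀ z ∉ H, 0 < (TabooChain.tabooGreen P ξ H z z).toReal := fun z hz =>
    ENNReal.toReal_pos (hξ.tabooGreen_self_pos hz (hA.diag_neg z)).ne'
      (hξ.tabooGreen_lt_top hirr hH hz (hA.diag_neg z)).ne
  refine ⟨hξ.tabooGreen_lt_top hirr hH hy (hA.diag_neg y),
    hξ.tabooGreen_self_pos hy (hA.diag_neg y),
    hξ.tabooGreen_lt_top hirr hH hy (hA.diag_neg y), fun hxy => ?_, fun hx => ?_⟩
  · rw [hξ.tabooHitProb_eq, hξ.tabooGreen_eq_of_ne hy hxy, ENNReal.toReal_mul,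
      mul_div_cancel_right₀ _ (hpos y hy).ne']
    rfl
  · have hAx := hA.diag_neg x
    have hG := hpos x hx
    have hF : TabooChain.tabooHitProb P ξ H x x =
        1 + 1 / (A x x * (TabooChain.tabooGreen P ξ H x x).toReal) := by
      -- Finiteness of the Green function carries the renewal equation to the reals, and its
      -- positivity allows solving for the return probability.
      have h := congrArg ENNReal.toReal (hξ.tabooGreen_self hx hAx)
      rw [ENNReal.toReal_add (ENNReal.mul_ne_top (measure_ne_top _ _)
        (hξ.tabooGreen_lt_top hirr hH hx hAx).ne) ENNReal.ofReal_ne_top, ENNReal.toReal_mul,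
        ENNReal.toReal_ofReal (div_nonneg_of_nonpos (by norm_num) hAx.le)] at h
      rw [hξ.tabooHitProb_eq, measureReal_def]
      have hAx' := hAx.ne
      have hG' := hG.ne'
      field_simp at h ⊢
      linarith
    refine ⟨hF, measureReal_nonneg, ?_⟩
    rw [hF]
    have : 1 / (A x x * (TabooChain.tabooGreen P ξ H x x).toReal) < 0 :=
      one_div_neg.2 (mul_neg_of_neg_of_pos hAx hG)
    linarith
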